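/- \textbf{Setting.} Fix a first-order language with at least one constant; its \emph{Herbrand universe} $HU$ is the set of its ground terms. A \emph{(general) logic program} $P$ over it is a finite list of clauses $A\leftarrow L_1,\dots,L_n$ with $A$ an atom and the $L_i$ literals. A \emph{moded query} $Q_0=p(\mathcal I_1,\dots,\mathcal I_m,T_1,\dots,T_n)$ is an atom some of whose arguments (in any positions) are input modes $\mathcal I_i$, the others being terms $T_j$. \emph{Generalized SLDNF-trees.} For an atom $A$, the tree $GT_{\leftarrow A}$ of $P$ has root $\leftarrow A$; the leftmost subgoal of each goal is selected. If it is positive, there is a child for each clause whose head, after renaming the clause with variables not yet used on the path, unifies with it; the child is the resolvent by an idempotent mgu that, when two variables are unified, keeps goal variables in preference to clause variables. The new subgoals have as ancestors the selected subgoal and its ancestors; the remaining subgoals keep theirs. If a ground subgoal $\neg B$ is selected, a negation arc leads to the root $\leftarrow B$ of a subsidiary tree, where $B$ inherits the ancestors of $\neg B$; if that SLDNF-tree is finitely failed, there is also a child in which $\neg B$ is dropped, and if it has a success leaf, the node is failed. Subsidiary trees stop at their first (leftmost) success leaf. A \emph{derivation} is a path from the root, and may cross negation arcs. Trees are determined up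 to the choice of renamings and mgus; the theorem holds for any such choice. The \emph{moded-query forest} $MF_{Q_0}$ consists of the trees $GT_{\leftarrow p(t_1,\dots,t_m,T_1,\dots,T_n)}$ with $t_1,\dots,t_m\in HU$. The \emph{moded generalized SLDNF-tree} $MT_{Q_0}$ is $GT_{\leftarrow p(I_1,\dots,I_m,T_1,\dots,T_n)}$, where $I_1,\dots,I_m$ are distinct variables, called \emph{input variables}, not occurring in any $T_j$; the mgus never replace an input variable by a non-input variable, and whenever an input variable is replaced by a compound term $f(\overline T)$, all variables of $\overline T$ become input variables. The \emph{symbol string} of an atom is the sequence of its predicate, function and constant symbols and variables read from left to right, every variable being replaced by one symbol $\mathcal X$. In a derivation, $G_j$ is a \emph{loop goal} of $G_i$ if the selected subgoals $A_i,A_j$ of $G_i,G_j$ are atoms with the same predicate symbol, $A_i$ is an ancestor of $A_j$, and the symbol string of $A_i$ is obtained from that of $A_j$ by removing zero or more elements. \textbf{Theorem.} Let $P$ be a logic program and $Q_0$ a moded query such that no non-ground negative subgoal is selected at any node of $MT_{Q_0}$ (that is, $Q_0$ is non-floundering). Then $MF_{Q_0}$ has an infinite derivation (i.e. some tree in it has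 one) if and only if $MT_{Q_0}$ has an infinite derivation $D$, with goals $G_0,G_1,G_2,\dots$, such that (i) there are indices $g_1<g_2<g_3<\cdots$ such that $G_{g_{j+1}}$ is a loop goal of $G_{g_j}$ for every $j\ge 1$; and (ii) for no input variable $I$ does $D$ contain an infinite chain of substitutions $$I/f_1(\dots,Y_1,\dots),\ \dots,\ Y_1/f_2(\dots,Y_2,\dots),\ \dots,\ Y_{i-1}/f_i(\dots,Y_i,\dots),\ \dots,$$ that is, substitutions made in the mgus of successively later steps of $D$, each $Y_i$ being a variable that occurs in the term substituted for $Y_{i-1}$ (with $Y_0=I$). -/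

import Mathlib

/-! # General logic programs, generalized SLDNF-trees and moded queries -/

namespace LogicProg

universe u v

/-! ## Syntax

Terms are Mathlib's first-order terms over a language `L`, with variables named by natural
numbers.  Constants are the function symbols of arity `0`. -/

/-- An atom `p(T₁, …, Tₙ)`. -/
structure Atom (L : FirstOrder.Language.{u, v}) where
  arity : ℕ
  pred : L.Relations arity
  args : Fin arity → L.Term ℕ

/-- A literal is an atom or the negation of an atom. -/
inductive Literal (L : FirstOrder.Language.{u, v}) where
  | pos (A : Atom L)
  | neg (A : Atom L)

/-- A clause `head ← body`. -/
structure Clause (L : FirstOrder.Language.{u, v}) where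
  head : Atom L
  body : List (Literal L)

/-- A general logic program: finitely many clauses, listed in the order in which they are tried. -/
abbrev Program (L : FirstOrder.Language.{u, v}) := List (Clause L)

/-- Substitutions (and variable renamings) are given by their action on variables. -/
abbrev Subst (L : FirstOrder.Language.{u, v}) := ℕ → L.Term ℕ

variable {L : FirstOrder.Language.{u, v}}

def Atom.vars (A : Atom L) : Finset ℕ :=
  Finset.univ.biUnion fun i => (A.args i).varFinset

def Atom.IsGround (A : Atom L) : Prop := A.vars = ∅

def Atom.subst (A : Atom L) (θ : Subst L) : Atom L :=
  ⟨A.arity, A.pred, fun i => (A.args i).subst θ⟩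

def Literal.atom : Literal L → Atom L
  | .pos A => A
  | .neg A => A

def Literal.subst (θ : Subst L) : Literal L → Literal L
  | .pos A => .pos (A.subst θ)
  | .neg A => .neg (A.subst θ)

def Clause.subst (C : Clause L) (θ : Subst L) : Clause L :=
  ⟨C.head.subst θ, C.body.map (Literal.subst θ)⟩

def Clause.vars (C : Clause L) : Finset ℕ :=
  C.head.vars ∪ (C.body.map fun l => l.atom.vars).foldr (· ∪ ·) ∅

/-- `C'` is obtained from `C` by renaming variables. -/
def Clause.IsVariant (C C' : Clause L) : Prop :=
  ∃ π : Equiv.Perm ℕ, C' = C.subst fun x => FirstOrder.Language.Term.var (π x)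

/-- The Herbrand universe of the underlying language: the set of its ground terms. -/
def herbrandUniverse (L : FirstOrder.Language.{u, v}) : Set (L.Term ℕ) :=
  {t | t.varFinset = ∅}

/-! ## Unification -/

/-- `θ` is a most general unifier of `A` and `B`. -/
def IsMgu (A B : Atom L) (θ : Subst L) : Prop :=
  A.subst θ = B.subst θ ∧
    ∀ σ : Subst L, A.subst σ = B.subst σ → ∃ δ : Subst L, ∀ x, σ x = (θ x).subst δ

/-- The mgus used in derivations, for a selected atom `A`, a (renamed) clause head `B` and a set
`I` of input variables.  They are idempotent and involve only the variables of `A` and `B`.  When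
a variable is bound to a variable, a variable of the clause is never substituted for a variable of
the goal, and a variable that is not an input variable is never substituted for an input
variable. -/
structure IsModedMgu (I : Finset ℕ) (A B : Atom L) (θ : Subst L) : Prop where
  isMgu : IsMgu A B θ
  idempotent : ∀ x, (θ x).subst θ = θ x
  support : ∀ x, x ∉ A.vars ∪ B.vars → θ x = FirstOrder.Language.Term.var x
  range : ∀ x ∈ A.vars ∪ B.vars, (θ x).varFinset ⊆ A.vars ∪ B.vars
  goal_var : ∀ x ∈ A.vars, ∀ y, θ x = FirstOrder.Language.Term.var y → y ∈ A.vars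
  input_var : ∀ x ∈ A.vars, x ∈ I → ∀ y, θ x = FirstOrder.Language.Term.var y → y ∈ I

/-! ## Nodes of generalized SLDNF-trees -/

/-- The edges below a node: apply the clause with a given index to a selected positive subgoal;
drop a selected negative subgoal by negation as failure; go, by a negation arc, to the root of the
subsidiary tree of a selected negative subgoal. -/
inductive Edge where
  | clause (k : ℕ)
  | naf
  | neg

/-- A subgoal with its ancestors.  As the ancestors of a subgoal are selected subgoals at nodes of
the path that leads to it, they are recorded by the depths of these nodes. -/
structure Subgoal (L : FirstOrder.Language.{u, v}) where
  lit : Literal L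
  anc : Finset ℕ

/-- A node of a generalized SLDNF-tree.  `path` is the sequence of edges from the root of the
generalized tree (the name of the node), `goal` the goal attached to it, `used` the set of
variables that occurred so far on the path, and `inputs` the set of variables that so far have
become input variables. -/
structure Node (L : FirstOrder.Language.{u, v}) where
  path : List Edge
  goal : List (Subgoal L)
  used : Finset ℕ
  inputs : Finset ℕ

def Node.depth (N : Node L) : ℕ := N.path.length

/-- `C'` is a variant of `C` with new variables, and `θ` a mgu of the atom `A` and the head
of `C'`, as used at the node `N`. -/
def IsResolution (N : Node L) (A : Atom L) (C C' : Clause L) (θ : Subst L) : Prop :=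
  C.IsVariant C' ∧ Disjoint C'.vars N.used ∧ IsModedMgu N.inputs A C'.head θ

/-- A rule that fixes, at each node, the renaming of each clause and the mgu; a clause is skipped
only if it cannot be resolved with the selected atom.  A generalized SLDNF-tree is determined by
the program and the top goal up to this choice. -/
structure ResolutionRule (L : FirstOrder.Language.{u, v}) where
  resolve : Node L → Atom L → Clause L → Option (Clause L × Subst L)
  sound : ∀ N A C C' θ, resolve N A C = some (C', θ) → IsResolution N A C C' θ
  complete : ∀ N A C, resolve N A C = none → ∀ C' θ, ¬ IsResolution N A C C' θ

open Classical in
/-- There are such rules. -/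
theorem ResolutionRule.nonempty (L : FirstOrder.Language.{u, v}) : Nonempty (ResolutionRule L) := by
  refine ⟨⟨fun N A C => if h : ∃ r : Clause L × Subst L, IsResolution N A C r.1 r.2
    then some h.choose else none, ?_, ?_⟩⟩
  · intro N A C C' θ h
    split_ifs at h with hr
    have e := hr.choose_spec
    rw [Option.some.injEq] at h
    rw [h] at e
    exact e
  · intro N A C h C' θ hr
    split_ifs at h with hn
    exact hn ⟨(C', θ), hr⟩

/-- The node obtained by applying clause number `k` of `P` to a selected positive subgoal, with
the mgu.  If an input variable is bound to a compound term, the variables of this term become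
input variables (if it is bound to a variable, that is an input variable already). -/
def Node.resolvent (R : ResolutionRule L) (P : Program L) (N : Node L) (k : ℕ) :
    Option (Subst L × Node L) :=
  match N.goal, P[k]? with
  | ⟨.pos A, anc⟩ :: rest, some C =>
      (R.resolve N A C).map fun r =>
        (r.2,
          { path := N.path ++ [Edge.clause k]
            goal := (r.1.body.map fun l => ⟨l.subst r.2, insert N.depth anc⟩) ++
              rest.map fun s => ⟨s.lit.subst r.2, s.anc⟩
            used := N.used ∪ r.1.vars
            inputs := N.inputs ∪ N.inputs.biUnion fun x => (r.2 x).varFinset })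
  | _, _ => none

open Classical in
/-- If the selected subgoal is `¬ A` with `A` ground: the root `← A` of the subsidiary tree.  The
subgoal `A` inherits the ancestors of `¬ A`. -/
noncomputable def Node.negationArc (N : Node L) : Option (Node L) :=
  match N.goal with
  | ⟨.neg A, anc⟩ :: _ =>
      if A.IsGround then
        some { N with path := N.path ++ [Edge.neg], goal := [⟨.pos A, anc⟩] }
      else none
  | _ => none

/-- If the selected subgoal is `¬ A`: the node in which this subgoal is dropped. -/
def Node.dropNegative (N : Node L) : Option (Node L) :=
  match N.goal with
  | ⟨.neg _, _⟩ :: rest => some { N with path := N.path ++ [Edge.naf], goal := rest }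
  | _ => none

inductive Outcome where
  | success
  | failure

/-- `Evaluates R P N success`: the SLDNF-tree with root `N` has a success leaf.
`Evaluates R P N failure`: the SLDNF-tree with root `N` is finitely failed. -/
inductive Evaluates (R : ResolutionRule L) (P : Program L) : Node L → Outcome → Prop
  | leaf (N : Node L) : N.goal = [] → Evaluates R P N .success
  | clause_success (N N' : Node L) (k : ℕ) (θ : Subst L) :
      N.resolvent R P k = some (θ, N') → Evaluates R P N' .success → Evaluates R P N .success
  | clause_failure (N : Node L) (A : Atom L) (anc : Finset ℕ) (rest : List (Subgoal L)) :
      N.goal = ⟨.pos A, anc⟩ :: rest →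
      (∀ k θ N', N.resolvent R P k = some (θ, N') → Evaluates R P N' .failure) →
      Evaluates R P N .failure
  | neg_failure (N M : Node L) :
      N.negationArc = some M → Evaluates R P M .success → Evaluates R P N .failure
  | neg_continue (N M N' : Node L) (o : Outcome) :
      N.negationArc = some M → Evaluates R P M .failure → N.dropNegative = some N' →
      Evaluates R P N' o → Evaluates R P N o

open Classical in
/-- The child of a node along an edge, with the substitution of this derivation step.  A
subsidiary tree, i.e. a tree entered by a negation arc, stops at its first success leaf: there, no
clause is applied once an earlier clause has led to a success leaf.  A selected subgoal `¬ A` is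
dropped if the subsidiary tree of `A` is finitely failed. -/
noncomputable def Node.child (R : ResolutionRule L) (P : Program L) (N : Node L) :
    Edge → Option (Subst L × Node L)
  | .clause k =>
      if Edge.neg ∈ N.path ∧
          ∃ j < k, ∃ θ M, N.resolvent R P j = some (θ, M) ∧ Evaluates R P M .success
      then none
      else N.resolvent R P k
  | .naf =>
      if ∃ M, N.negationArc = some M ∧ Evaluates R P M .failure
      then N.dropNegative.map fun N' => (FirstOrder.Language.Term.var, N')
      else none
  | .neg => N.negationArc.map fun N' => (FirstOrder.Language.Term.var, N')

/-! ## Generalized SLDNF-trees and their infinite derivations -/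

structure GenTree (L : FirstOrder.Language.{u, v}) where
  root : Node L
  child : Node L → Edge → Option (Subst L × Node L)

/-- The nodes of a tree. -/
inductive GenTree.IsNode (T : GenTree L) : Node L → Prop
  | root : T.IsNode T.root
  | child (N N' : Node L) (e : Edge) (θ : Subst L) :
      T.IsNode N → T.child N e = some (θ, N') → T.IsNode N'

/-- The generalized SLDNF-tree of `P` for the top goal `← A`, where the variables in `I` are
input variables. -/
noncomputable def genSLDNFTree (R : ResolutionRule L) (P : Program L) (A : Atom L)
    (I : Finset ℕ) : GenTree L where
  root := { path := [], goal := [⟨.pos A, ∅⟩], used := A.vars, inputs := I }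
  child := Node.child R P

/-- No non-ground negative subgoal is selected at any node. -/
def GenTree.NonFloundering (T : GenTree L) : Prop :=
  ∀ N, T.IsNode N → ∀ A anc rest, N.goal = ⟨.neg A, anc⟩ :: rest → A.IsGround

/-- An infinite (generalized SLDNF-) derivation: an infinite path that starts at the root. -/
structure GenTree.InfiniteDerivation (T : GenTree L) where
  node : ℕ → Node L
  edge : ℕ → Edge
  subst : ℕ → Subst L
  start : node 0 = T.root
  step : ∀ i, T.child (node i) (edge i) = some (subst i, node (i + 1))

/-! ## Loop goals -/

/-- The elements of symbol strings; `X` stands for any variable. -/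
inductive Symbol (L : FirstOrder.Language.{u, v}) where
  | pred {n : ℕ} (p : L.Relations n)
  | func {n : ℕ} (f : L.Functions n)
  | X

def termSymbolString : L.Term ℕ → List (Symbol L)
  | .var _ => [Symbol.X]
  | .func f ts => Symbol.func f :: (List.ofFn fun i => termSymbolString (ts i)).flatten

def Atom.symbolString (A : Atom L) : List (Symbol L) :=
  Symbol.pred A.pred :: (List.ofFn fun i => termSymbolString (A.args i)).flatten

/-- `A` and `B` have the same predicate symbol, and the symbol string of `A` is obtained from the
symbol string of `B` by removing zero or more elements. -/
def Atom.LoopsInto (A B : Atom L) : Prop :=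
  (⟨A.arity, A.pred⟩ : Σ n, L.Relations n) = ⟨B.arity, B.pred⟩ ∧
    A.symbolString.Sublist B.symbolString

/-- The goal at the `j`-th node of `D` is a loop goal of the goal at the `i`-th node: the selected
subgoals are positive, the one at node `i` is an ancestor of the one at node `j`, and it loops
into it. -/
def GenTree.InfiniteDerivation.IsLoopGoal {T : GenTree L} (D : T.InfiniteDerivation)
    (i j : ℕ) : Prop :=
  ∃ A anc rest B anc' rest',
    (D.node i).goal = ⟨.pos A, anc⟩ :: rest ∧ (D.node j).goal = ⟨.pos B, anc'⟩ :: rest' ∧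
      i ∈ anc' ∧ A.LoopsInto B

/-- `D` contains an infinite chain of substitutions
`x/f₁(…, Y₁, …), …, Y₁/f₂(…, Y₂, …), …` for the input variable `x`; the `n`-th substitution of
the chain is made in the step from node `s n`. -/
def GenTree.InfiniteDerivation.HasInfiniteChain {T : GenTree L} (D : T.InfiniteDerivation)
    (x : ℕ) : Prop :=
  ∃ (Y : ℕ → ℕ) (s : ℕ → ℕ), StrictMono s ∧ Y 0 = x ∧ x ∈ (D.node (s 0)).inputs ∧
    ∀ n, ∃ (m : ℕ) (f : L.Functions m) (ts : Fin m → L.Term ℕ),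
      D.subst (s n) (Y n) = FirstOrder.Language.Term.func f ts ∧
        Y (n + 1) ∈ (FirstOrder.Language.Term.func f ts).varFinset

/-! ## Moded queries -/

/-- A moded query: an atom some of whose arguments (those equal to `none`) are input modes. -/
structure ModedQuery (L : FirstOrder.Language.{u, v}) where
  arity : ℕ
  pred : L.Relations arity
  args : Fin arity → Option (L.Term ℕ)

/-- Replace the input mode at each position `i` where there is one by `t i`. -/
def ModedQuery.instantiate (Q : ModedQuery L) (t : Fin Q.arity → L.Term ℕ) : Atom L :=
  ⟨Q.arity, Q.pred, fun i => (Q.args i).getD (t i)⟩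

/-- The positions of the input modes. -/
def ModedQuery.inputPositions (Q : ModedQuery L) : Finset (Fin Q.arity) :=
  Finset.univ.filter fun i => (Q.args i).isNone

/-- The variables `ι i`, for `i` an input position, are distinct and do not occur in the other
arguments of the query. -/
def ModedQuery.IsNaming (Q : ModedQuery L) (ι : Fin Q.arity → ℕ) : Prop :=
  Set.InjOn ι Q.inputPositions ∧
    ∀ i ∈ Q.inputPositions, ∀ j t, Q.args j = some t → ι i ∉ t.varFinset

/-- The moded-query forest of `P` for `Q`: the generalized SLDNF-trees for all the instances of
`Q` by elements of the Herbrand universe (each tree being built with its own resolution rule). -/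
def modedQueryForest (P : Program L) (Q : ModedQuery L)
    (R : (Fin Q.arity → L.Term ℕ) → ResolutionRule L) : Set (GenTree L) :=
  {T | ∃ t : Fin Q.arity → L.Term ℕ, (∀ i, t i ∈ herbrandUniverse L) ∧
    T = genSLDNFTree (R t) P (Q.instantiate t) ∅}

/-- The moded generalized SLDNF-tree of `P` for `Q`, with input variables named by `ι`. -/
noncomputable def modedTree (P : Program L) (Q : ModedQuery L) (ι : Fin Q.arity → ℕ)
    (R : ResolutionRule L) : GenTree L :=
  genSLDNFTree R P (Q.instantiate fun i => FirstOrder.Language.Term.var (ι i)) (Q.inputPositions.image ι)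

end LogicProg

namespace LogicProg

open FirstOrder.Language (Term)

universe u v

variable {L : FirstOrder.Language.{u, v}}

/-! ## Terms and substitutions -/

/-! The proof runs a derivation of the moded tree and a derivation of a tree of the forest in
parallel, along the same edges. The invariant `Tracks` says that the forest goal is a variant of the
moded goal under a substitution `γ` that grounds the current input variables. Resolution preserves
it in both directions. Upwards (`Tracks.lift_child`), a unifier of the instances yields a unifier of
the original atoms, so an mgu exists, and `γ` extends to the new input variables without changing on
the old ones. Downwards (`Tracks.child`), a step with mgu `θ` can be repeated on the instance when
`γ x = (θ x)γ₁` on the input variables for some next grounding `γ₁`. At a negative step both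
selected atoms are ground, hence equal (upwards this is where non-floundering enters), and the
subsidiary trees agree because evaluation depends on the goal only up to variants
(`Evaluates.of_variant`).

Condition (i) holds in every infinite derivation (`exists_loop_goals`). Infinitely many selected
positive subgoals are ancestors of everything selected after them (`exists_permanent`). Mgus
introduce no function symbols beyond those of the program and the query, so the symbol strings of
these subgoals are words over a finite alphabet, and Higman's lemma gives an infinite subsequence
increasing for the subsequence order.

For condition (ii), a lifted derivation has no infinite chain: each variable of a chain has a fixed
ground value under the groundings, and passing from `Yₙ` to `Yₙ₊₁` goes to a proper subterm of that
value, so sizes decrease (`exists_lifted_derivation`). Conversely, suppose that there is no infinite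
chain. An input variable is bound at most once, so the relation "occurs in the compound term bound
to" is finitely branching. König's lemma leaves only finitely many input variables, and from some
node on none is bound. Substituting a constant from there on and going back through the mgus gives
compatible groundings, along which the derivation is carried down to the forest
(`exists_ground_instances`, `exists_instance_derivation`). -/

theorem subst_var (t : L.Term ℕ) : t.subst Term.var = t := by
  induction t with
  | var => rfl
  | func f ts ih => simp [Term.subst, ih]

theorem subst_subst (t : L.Term ℕ) (σ τ : Subst L) :
    (t.subst σ).subst τ = t.subst fun x => (σ x).subst τ := by
  induction t with
  | var => rfl
  | func f ts ih => simp [Term.subst, ih]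

theorem subst_eq_subst_iff (t : L.Term ℕ) (σ τ : Subst L) :
    t.subst σ = t.subst τ ↔ ∀ x ∈ t.varFinset, σ x = τ x := by
  induction t with
  | var => simp [Term.subst]
  | func f ts ih =>
    simp only [Term.subst, Term.func.injEq, heq_eq_eq, true_and, Term.varFinset,
      Finset.mem_biUnion, Finset.mem_univ]
    rw [funext_iff]
    simp only [ih]
    exact ⟨fun h x ⟨i, hi⟩ => h i x hi, fun h i x hx => h x ⟨i, hx⟩⟩

theorem subst_congr {t : L.Term ℕ} {σ τ : Subst L} (h : ∀ x ∈ t.varFinset, σ x = τ x) :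
    t.subst σ = t.subst τ :=
  (subst_eq_subst_iff t σ τ).2 h

theorem subst_eq_self_iff (t : L.Term ℕ) (σ : Subst L) :
    t.subst σ = t ↔ ∀ x ∈ t.varFinset, σ x = Term.var x := by
  rw [← subst_eq_subst_iff, subst_var]

theorem subst_eq_self_of_ground {t : L.Term ℕ} (h : t.varFinset = ∅) (σ : Subst L) :
    t.subst σ = t :=
  (subst_eq_self_iff t σ).2 (by simp [h])

theorem mem_varFinset_subst (t : L.Term ℕ) (σ : Subst L) (y : ℕ) :
    y ∈ (t.subst σ).varFinset ↔ ∃ x ∈ t.varFinset, y ∈ (σ x).varFinset := by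
  induction t with
  | var => simp [Term.subst]
  | func f ts ih =>
    simp only [Term.subst, Term.varFinset, Finset.mem_biUnion, Finset.mem_univ, true_and, ih]
    exact ⟨fun ⟨i, x, hx, hy⟩ => ⟨x, ⟨i, hx⟩, hy⟩, fun ⟨x, ⟨i, hx⟩, hy⟩ => ⟨i, x, hx, hy⟩⟩

/-- The number of nodes of a term. -/
def termSize : L.Term ℕ → ℕ
  | .var _ => 1
  | .func _ ts => 1 + ∑ i, termSize (ts i)

theorem termSize_pos (t : L.Term ℕ) : 0 < termSize t := by
  cases t <;> simp [termSize]

theorem termSize_subst_var_le {t : L.Term ℕ} {x : ℕ} (σ : Subst L) (h : x ∈ t.varFinset) :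
    termSize (σ x) ≤ termSize (t.subst σ) := by
  induction t with
  | var y =>
    simp only [Term.varFinset, Finset.mem_singleton] at h
    simp [Term.subst, h]
  | func f ts ih =>
    simp only [Term.varFinset, Finset.mem_biUnion, Finset.mem_univ, true_and] at h
    obtain ⟨i, hi⟩ := h
    have h1 := ih i hi
    have h2 := Finset.single_le_sum (f := fun i => termSize ((ts i).subst σ))
      (fun _ _ => Nat.zero_le _) (Finset.mem_univ i)
    simp only [Term.subst, termSize] at *
    omega

/-- A variable of a compound term occupies a proper subterm. This serves twice: as the occurs check
in unification, and as the descent that excludes infinite chains in lifted derivations. -/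
theorem termSize_subst_var_lt {n : ℕ} {f : L.Functions n} {ts : Fin n → L.Term ℕ} {x : ℕ}
    (σ : Subst L) (h : x ∈ (Term.func f ts).varFinset) :
    termSize (σ x) < termSize ((Term.func f ts).subst σ) := by
  simp only [Term.varFinset, Finset.mem_biUnion, Finset.mem_univ, true_and] at h
  obtain ⟨i, hi⟩ := h
  have h1 := termSize_subst_var_le σ hi
  have h2 := Finset.single_le_sum (f := fun i => termSize ((ts i).subst σ))
    (fun _ _ => Nat.zero_le _) (Finset.mem_univ i)
  simp only [Term.subst, termSize] at *
  omega

/-- All function symbols of the term are in `S`. -/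
def FuncsIn (S : Set (Σ n, L.Functions n)) : L.Term ℕ → Prop
  | .var _ => True
  | .func f ts => ⟨_, f⟩ ∈ S ∧ ∀ i, FuncsIn S (ts i)

theorem funcsIn_subst (S : Set (Σ n, L.Functions n)) (t : L.Term ℕ) (σ : Subst L) :
    FuncsIn S (t.subst σ) ↔ FuncsIn S t ∧ ∀ x ∈ t.varFinset, FuncsIn S (σ x) := by
  induction t with
  | var => simp [Term.subst, FuncsIn]
  | func f ts ih =>
    simp only [Term.subst, FuncsIn, ih, Term.varFinset, Finset.mem_biUnion, Finset.mem_univ,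
      true_and]
    constructor
    · rintro ⟨h, h'⟩
      exact ⟨⟨h, fun i => (h' i).1⟩, fun x ⟨i, hi⟩ => (h' i).2 x hi⟩
    · rintro ⟨⟨h, h'⟩, h''⟩
      exact ⟨h, fun i => ⟨h' i, fun x hx => h'' x ⟨i, hx⟩⟩⟩

/-! ## Unification -/

/-- `σ` solves the equations `E`. -/
def Solves (E : List (L.Term ℕ × L.Term ℕ)) (σ : Subst L) : Prop :=
  ∀ e ∈ E, e.1.subst σ = e.2.subst σ

theorem solves_cons {e : L.Term ℕ × L.Term ℕ} {E : List (L.Term ℕ × L.Term ℕ)} {σ : Subst L} :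
    Solves (e :: E) σ ↔ e.1.subst σ = e.2.subst σ ∧ Solves E σ := by
  simp [Solves]

/-- `θ` solves `E`, is absorbed by all solutions of `E`, moves only variables in `V` and introduces
only variables in `V` and function symbols in `S`. -/
structure IsSolved (V : Set ℕ) (S : Set (Σ n, L.Functions n)) (E : List (L.Term ℕ × L.Term ℕ))
    (θ : Subst L) : Prop where
  solves : Solves E θ
  absorb : ∀ σ, Solves E σ → ∀ x, (θ x).subst σ = σ x
  support : ∀ x ∉ V, θ x = Term.var x
  range : ∀ x ∈ V, ↑(θ x).varFinset ⊆ V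
  funcs : ∀ x, FuncsIn S (θ x)

/-- The terms of `E` have their variables in `V` and their function symbols in `S`. -/
def EqsIn (V : Set ℕ) (S : Set (Σ n, L.Functions n)) (E : List (L.Term ℕ × L.Term ℕ)) : Prop :=
  ∀ e ∈ E, (↑e.1.varFinset ⊆ V ∧ FuncsIn S e.1) ∧ (↑e.2.varFinset ⊆ V ∧ FuncsIn S e.2)

theorem eqsIn_cons {V : Set ℕ} {S : Set (Σ n, L.Functions n)} {e : L.Term ℕ × L.Term ℕ}
    {E : List (L.Term ℕ × L.Term ℕ)} :
    EqsIn V S (e :: E) ↔ ((↑e.1.varFinset ⊆ V ∧ FuncsIn S e.1) ∧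
      (↑e.2.varFinset ⊆ V ∧ FuncsIn S e.2)) ∧ EqsIn V S E := by
  simp [EqsIn]

/-- The size of the instances of the equations under a solution. -/
def eqsSize (E : List (L.Term ℕ × L.Term ℕ)) (σ : Subst L) : ℕ :=
  (E.map fun e => termSize (e.1.subst σ)).sum

theorem IsSolved.of_equiv {V : Set ℕ} {S : Set (Σ n, L.Functions n)}
    {E F : List (L.Term ℕ × L.Term ℕ)} {θ : Subst L} (h : IsSolved V S E θ)
    (hEF : ∀ σ, Solves E σ ↔ Solves F σ) : IsSolved V S F θ :=
  ⟨(hEF θ).1 h.solves, fun σ hσ => h.absorb σ ((hEF σ).2 hσ), h.support, h.range, h.funcs⟩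

/-- The substitution of `t` for `x`. -/
def single (x : ℕ) (t : L.Term ℕ) : Subst L := fun y => if y = x then t else Term.var y

theorem single_absorb {x : ℕ} {t : L.Term ℕ} {σ : Subst L} (h : σ x = t.subst σ) (y : ℕ) :
    (single x t y).subst σ = σ y := by
  unfold single
  split_ifs with hy
  · rw [hy, h]
  · rfl

theorem single_absorb_term {x : ℕ} {t : L.Term ℕ} {σ : Subst L} (h : σ x = t.subst σ)
    (s : L.Term ℕ) : (s.subst (single x t)).subst σ = s.subst σ := by
  rw [subst_subst]
  exact subst_congr fun y _ => single_absorb h y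

/-- Substitute `t` for `x` in all the equations. -/
def eqsSubst (x : ℕ) (t : L.Term ℕ) (E : List (L.Term ℕ × L.Term ℕ)) :
    List (L.Term ℕ × L.Term ℕ) :=
  E.map fun e => (e.1.subst (single x t), e.2.subst (single x t))

theorem solves_eqsSubst {x : ℕ} {t : L.Term ℕ} {σ : Subst L} (h : σ x = t.subst σ)
    (E : List (L.Term ℕ × L.Term ℕ)) : Solves (eqsSubst x t E) σ ↔ Solves E σ := by
  simp only [Solves, eqsSubst, List.forall_mem_map, single_absorb_term h]

theorem eqsIn_eqsSubst {V : Set ℕ} {S : Set (Σ n, L.Functions n)} {x : ℕ} {t : L.Term ℕ}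
    (ht : ↑t.varFinset ⊆ V ∧ FuncsIn S t) {E : List (L.Term ℕ × L.Term ℕ)} (hE : EqsIn V S E) :
    EqsIn V S (eqsSubst x t E) := by
  have key : ∀ s : L.Term ℕ, (↑s.varFinset ⊆ V ∧ FuncsIn S s) →
      ↑(s.subst (single x t)).varFinset ⊆ V ∧ FuncsIn S (s.subst (single x t)) := by
    intro s hs
    refine ⟨fun y hy => ?_, (funcsIn_subst _ _ _).2 ⟨hs.2, fun y _ => ?_⟩⟩
    · obtain ⟨z, hz, hy⟩ := (mem_varFinset_subst _ _ _).1 hy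
      unfold single at hy
      split_ifs at hy
      · exact ht.1 hy
      · simp only [Term.varFinset, Finset.mem_singleton] at hy
        exact hy ▸ hs.1 hz
    · unfold single
      split_ifs
      · exact ht.2
      · trivial
  intro e he
  obtain ⟨e', he', rfl⟩ := List.mem_map.1 he
  exact ⟨key _ (hE e' he').1, key _ (hE e' he').2⟩

theorem subst_single_of_notMem {x : ℕ} {s t : L.Term ℕ} (h : x ∉ s.varFinset) :
    s.subst (single x t) = s := by
  refine (subst_eq_self_iff _ _).2 fun y hy => ?_
  have : y ≠ x := fun e => h (e ▸ hy)
  simp [single, this]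

/-- Variable elimination: solve the system after replacing `x` by `t`, then precompose with that
replacement. Absorption survives because every solution of `x = t` already identifies `x` with `t`.
-/
theorem IsSolved.eliminate {V : Set ℕ} {S : Set (Σ n, L.Functions n)} {x : ℕ} {t : L.Term ℕ}
    {E : List (L.Term ℕ × L.Term ℕ)} {θ : Subst L} (hx : x ∈ V)
    (ht : ↑t.varFinset ⊆ V ∧ FuncsIn S t) (hxt : x ∉ t.varFinset)
    (h : IsSolved V S (eqsSubst x t E) θ) :
    IsSolved V S ((Term.var x, t) :: E) fun y => (single x t y).subst θ := by
  have comp : ∀ s : L.Term ℕ, (s.subst fun y => (single x t y).subst θ) =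
      (s.subst (single x t)).subst θ := fun s => (subst_subst _ _ _).symm
  refine ⟨solves_cons.2 ⟨?_, ?_⟩, ?_, ?_, ?_, ?_⟩
  · rw [comp t, subst_single_of_notMem hxt]
    simp [Term.subst, single]
  · intro e he
    rw [comp, comp]
    exact h.solves _ (List.mem_map_of_mem (f := fun e : L.Term ℕ × L.Term ℕ =>
      (e.1.subst (single x t), e.2.subst (single x t))) he)
  · intro σ hσ y
    obtain ⟨h1, h2⟩ := solves_cons.1 hσ
    have h1' : σ x = t.subst σ := h1
    rw [subst_subst]
    simp only [h.absorb σ ((solves_eqsSubst h1' E).2 h2)]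
    exact single_absorb h1' y
  · intro y hy
    have : y ≠ x := fun e => hy (e ▸ hx)
    simp [single, this, Term.subst, h.support y hy]
  · intro y hy z hz
    obtain ⟨w, hw, hz⟩ := (mem_varFinset_subst _ _ _).1 hz
    have hwV : w ∈ V := by
      unfold single at hw
      split_ifs at hw
      · exact ht.1 hw
      · simp only [Term.varFinset, Finset.mem_singleton] at hw
        exact hw ▸ hy
    exact h.range w hwV hz
  · intro y
    refine (funcsIn_subst _ _ _).2 ⟨?_, fun z _ => h.funcs z⟩
    unfold single
    split_ifs
    · exact ht.2
    · trivial

/-- Martelli–Montanari unification for a system known to have a solution `σ`. Elimination may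
enlarge the terms of the system, but not their instances under `σ`; the induction is therefore on
the total size of these instances. -/
theorem exists_isSolved (V : Set ℕ) (S : Set (Σ n, L.Functions n)) (σ : Subst L) :
    ∀ (n : ℕ) (E : List (L.Term ℕ × L.Term ℕ)), eqsSize E σ ≤ n → EqsIn V S E → Solves E σ →
      ∃ θ, IsSolved V S E θ := by
  intro n
  induction n using Nat.strong_induction_on with
  | _ n ih =>
  have elim : ∀ (x : ℕ) (t : L.Term ℕ) (E : List (L.Term ℕ × L.Term ℕ)),
      eqsSize ((Term.var x, t) :: E) σ ≤ n → EqsIn V S ((Term.var x, t) :: E) →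
      Solves ((Term.var x, t) :: E) σ → ∃ θ, IsSolved V S ((Term.var x, t) :: E) θ := by
    intro x t E hn hE hσ
    obtain ⟨h1, h2⟩ := solves_cons.1 hσ
    have h1' : σ x = t.subst σ := h1
    obtain ⟨⟨hx, ht⟩, hE'⟩ := eqsIn_cons.1 hE
    have hxV : x ∈ V := hx.1 (by simp)
    have hpos := termSize_pos (σ x)
    have hn' : termSize (σ x) + eqsSize E σ ≤ n := by simpa [eqsSize, Term.subst] using hn
    by_cases hxt : x ∈ t.varFinset
    · cases t with
      | var y =>
        simp only [Term.varFinset, Finset.mem_singleton] at hxt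
        subst hxt
        obtain ⟨θ, hθ⟩ := ih (n - 1) (by omega) E (by omega) hE' h2
        exact ⟨θ, hθ.of_equiv fun τ => by simp [solves_cons]⟩
      | func f ts =>
        -- Occurs check: `σ x` would be strictly smaller than the instance of a term that it equals.
        have := termSize_subst_var_lt σ hxt
        rw [← h1'] at this
        exact absurd this (lt_irrefl _)
    · have hsz : eqsSize (eqsSubst x t E) σ = eqsSize E σ := by
        simp [eqsSize, eqsSubst, Function.comp_def, single_absorb_term h1']
      obtain ⟨θ, hθ⟩ := ih (n - 1) (by omega) (eqsSubst x t E) (by omega)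
        (eqsIn_eqsSubst ht hE') ((solves_eqsSubst h1' E).2 h2)
      exact ⟨_, hθ.eliminate hxV ht hxt⟩
  intro E hn hE hσ
  match E with
  | [] =>
    exact ⟨Term.var, by simp [Solves], fun τ _ x => rfl, fun _ _ => rfl,
      fun x hx => by simpa using hx, fun _ => trivial⟩
  | (Term.var x, t) :: E => exact elim x t E hn hE hσ
  | (Term.func f ts, Term.var x) :: E =>
    obtain ⟨h1, h2⟩ := solves_cons.1 hσ
    obtain ⟨⟨h3, h4⟩, h5⟩ := eqsIn_cons.1 hE
    obtain ⟨θ, hθ⟩ := elim x (Term.func f ts) E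
      (by simp only [eqsSize, List.map_cons, List.sum_cons] at hn ⊢; rwa [← h1])
      (eqsIn_cons.2 ⟨⟨h4, h3⟩, h5⟩) (solves_cons.2 ⟨h1.symm, h2⟩)
    exact ⟨θ, hθ.of_equiv fun τ => by simp [solves_cons, eq_comm]⟩
  | (@Term.func _ _ k f ts, @Term.func _ _ l g us) :: E =>
    obtain ⟨h1, h2⟩ := solves_cons.1 hσ
    obtain ⟨⟨h3, h4⟩, h5⟩ := eqsIn_cons.1 hE
    simp only [Term.subst, Term.func.injEq] at h1
    obtain ⟨rfl, h1, h1'⟩ := h1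
    obtain rfl := eq_of_heq h1
    have h1' := eq_of_heq h1'
    have hequiv : ∀ τ : Subst L, Solves (List.ofFn (fun i => (ts i, us i)) ++ E) τ ↔
        Solves ((Term.func f ts, Term.func f us) :: E) τ := by
      intro τ
      simp [Solves, Term.subst, List.mem_ofFn, or_imp, forall_and, funext_iff]
    -- Decomposition removes exactly one head symbol from the counted left-hand sides.
    have hsz : eqsSize (List.ofFn (fun i => (ts i, us i)) ++ E) σ + 1 =
        eqsSize ((Term.func f ts, Term.func f us) :: E) σ := by
      simp only [eqsSize, List.map_append, List.sum_append, List.map_ofFn, List.sum_ofFn,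
        List.map_cons, List.sum_cons, Term.subst, termSize, Function.comp_apply]
      ring
    obtain ⟨θ, hθ⟩ := ih (n - 1) (by omega) (List.ofFn (fun i => (ts i, us i)) ++ E) (by omega)
      (by
        intro e he
        rcases List.mem_append.1 he with he | he
        · obtain ⟨i, rfl⟩ := List.mem_ofFn.1 he
          refine ⟨⟨fun y hy => h3.1 ?_, h3.2.2 i⟩, fun y hy => h4.1 ?_, h4.2.2 i⟩ <;>
          · simp only [Term.varFinset, Finset.coe_biUnion, Set.mem_iUnion]
            exact ⟨i, by simp, hy⟩
        · exact h5 e he)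
      ((hequiv σ).2 hσ)
    exact ⟨θ, hθ.of_equiv hequiv⟩

/-! ## Atoms and literals -/

theorem Atom.mem_vars {A : Atom L} {x : ℕ} : x ∈ A.vars ↔ ∃ i, x ∈ (A.args i).varFinset := by
  simp [Atom.vars]

theorem Atom.subst_subst (A : Atom L) (σ τ : Subst L) :
    (A.subst σ).subst τ = A.subst fun x => (σ x).subst τ := by
  simp [Atom.subst, LogicProg.subst_subst]

theorem Atom.subst_eq_subst_iff (A : Atom L) (σ τ : Subst L) :
    A.subst σ = A.subst τ ↔ ∀ x ∈ A.vars, σ x = τ x := by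
  simp only [Atom.subst, Atom.mk.injEq, heq_eq_eq, true_and, funext_iff,
    LogicProg.subst_eq_subst_iff, Atom.mem_vars]
  exact ⟨fun h x ⟨i, hi⟩ => h i x hi, fun h i x hx => h x ⟨i, hx⟩⟩

theorem Atom.subst_var (A : Atom L) : A.subst Term.var = A := by
  simp [Atom.subst, LogicProg.subst_var]

theorem Atom.mem_vars_subst (A : Atom L) (σ : Subst L) (y : ℕ) :
    y ∈ (A.subst σ).vars ↔ ∃ x ∈ A.vars, y ∈ (σ x).varFinset := by
  simp only [Atom.mem_vars, Atom.subst, mem_varFinset_subst]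
  exact ⟨fun ⟨i, x, hx, hy⟩ => ⟨x, ⟨i, hx⟩, hy⟩, fun ⟨x, ⟨i, hx⟩, hy⟩ => ⟨i, x, hx, hy⟩⟩

theorem Atom.IsGround.subst_eq {A : Atom L} (h : A.IsGround) (σ : Subst L) : A.subst σ = A := by
  conv_rhs => rw [← A.subst_var]
  refine (A.subst_eq_subst_iff _ _).2 fun x hx => ?_
  rw [Atom.IsGround] at h
  simp [h] at hx

/-- All function symbols of the atom are in `S`. -/
def Atom.FuncsIn (S : Set (Σ n, L.Functions n)) (A : Atom L) : Prop :=
  ∀ i, LogicProg.FuncsIn S (A.args i)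

theorem Atom.funcsIn_subst (S : Set (Σ n, L.Functions n)) (A : Atom L) (σ : Subst L) :
    (A.subst σ).FuncsIn S ↔ A.FuncsIn S ∧ ∀ x ∈ A.vars, LogicProg.FuncsIn S (σ x) := by
  simp only [Atom.FuncsIn, Atom.subst, LogicProg.funcsIn_subst, Atom.mem_vars]
  exact ⟨fun h => ⟨fun i => (h i).1, fun x ⟨i, hi⟩ => (h i).2 x hi⟩,
    fun h i => ⟨h.1 i, fun x hx => h.2 x ⟨i, hx⟩⟩⟩

theorem Literal.subst_subst (l : Literal L) (σ τ : Subst L) :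
    (l.subst σ).subst τ = l.subst fun x => (σ x).subst τ := by
  cases l <;> simp [Literal.subst, Atom.subst_subst]

theorem Literal.subst_eq_subst_iff (l : Literal L) (σ τ : Subst L) :
    l.subst σ = l.subst τ ↔ ∀ x ∈ l.atom.vars, σ x = τ x := by
  cases l <;> simp [Literal.subst, Literal.atom, Atom.subst_eq_subst_iff]

theorem Literal.subst_var (l : Literal L) : l.subst Term.var = l := by
  cases l <;> simp [Literal.subst, Atom.subst_var]

theorem Literal.atom_subst (l : Literal L) (σ : Subst L) : (l.subst σ).atom = l.atom.subst σ := by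
  cases l <;> rfl

/-- `x` occurs in one of the literals. -/
def OccursIn (x : ℕ) (ls : List (Literal L)) : Prop := ∃ l ∈ ls, x ∈ l.atom.vars

theorem occursIn_cons {x : ℕ} {l : Literal L} {ls : List (Literal L)} :
    OccursIn x (l :: ls) ↔ x ∈ l.atom.vars ∨ OccursIn x ls := by
  simp [OccursIn]

theorem occursIn_append {x : ℕ} {ls ms : List (Literal L)} :
    OccursIn x (ls ++ ms) ↔ OccursIn x ls ∨ OccursIn x ms := by
  simp [OccursIn, or_and_right, exists_or]

theorem occursIn_map_subst {y : ℕ} {ls : List (Literal L)} {σ : Subst L} :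
    OccursIn y (ls.map (Literal.subst σ)) ↔ ∃ x, OccursIn x ls ∧ y ∈ (σ x).varFinset := by
  simp only [OccursIn, List.mem_map]
  constructor
  · rintro ⟨_, ⟨l, hl, rfl⟩, hy⟩
    rw [Literal.atom_subst, Atom.mem_vars_subst] at hy
    obtain ⟨x, hx, hy⟩ := hy
    exact ⟨x, ⟨l, hl, hx⟩, hy⟩
  · rintro ⟨x, ⟨l, hl, hx⟩, hy⟩
    exact ⟨_, ⟨l, hl, rfl⟩, by rw [Literal.atom_subst, Atom.mem_vars_subst]; exact ⟨x, hx, hy⟩⟩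

theorem map_subst_eq_iff {ls : List (Literal L)} {σ τ : Subst L} :
    ls.map (Literal.subst σ) = ls.map (Literal.subst τ) ↔ ∀ x, OccursIn x ls → σ x = τ x := by
  simp only [List.map_inj_left, Literal.subst_eq_subst_iff, OccursIn]
  exact ⟨fun h x ⟨l, hl, hx⟩ => h l hl x hx, fun h l hl x hx => h x ⟨l, hl, hx⟩⟩

theorem map_subst_subst (ls : List (Literal L)) (σ τ : Subst L) :
    (ls.map (Literal.subst σ)).map (Literal.subst τ) =
      ls.map (Literal.subst fun x => (σ x).subst τ) := by
  simp [Function.comp_def, Literal.subst_subst]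

theorem map_subst_var (ls : List (Literal L)) : ls.map (Literal.subst Term.var) = ls := by
  simp [funext Literal.subst_var]

/-! ## Clauses and their variants -/

/-- The literals of a clause, the head included. -/
def Clause.lits (C : Clause L) : List (Literal L) := .pos C.head :: C.body

theorem Clause.mem_vars {C : Clause L} {x : ℕ} : x ∈ C.vars ↔ OccursIn x C.lits := by
  have : ∀ ls : List (Literal L),
      x ∈ (ls.map fun l => l.atom.vars).foldr (· ∪ ·) ∅ ↔ OccursIn x ls := by
    intro ls
    induction ls with
    | nil => simp [OccursIn]
    | cons l ls ih => simp [occursIn_cons, ih]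
  rw [Clause.vars, Finset.mem_union, this, Clause.lits, occursIn_cons]
  rfl

theorem Clause.lits_subst (C : Clause L) (σ : Subst L) :
    (C.subst σ).lits = C.lits.map (Literal.subst σ) := by
  simp [Clause.lits, Clause.subst, Literal.subst]

/-- Go back to `C` by one renaming and forward by the other. Both directions are recorded because
`IsInputInstance` needs a substitution each way. -/
theorem Clause.IsVariant.exists_rename {C K K' : Clause L} (h : C.IsVariant K)
    (h' : C.IsVariant K') : ∃ r r' : ℕ → ℕ,
      K.lits.map (Literal.subst fun x => Term.var (r x)) = K'.lits ∧
      K'.lits.map (Literal.subst fun x => Term.var (r' x)) = K.lits := by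
  obtain ⟨π, rfl⟩ := h
  obtain ⟨π', rfl⟩ := h'
  refine ⟨fun x => π' (π.symm x), fun x => π (π'.symm x), ?_, ?_⟩ <;>
  simp [Clause.lits_subst, map_subst_subst, Term.subst, -List.map_map]

theorem exists_perm_disjoint (s t : Finset ℕ) :
    ∃ π : Equiv.Perm ℕ, ∀ x ∈ s, π x ∉ t := by
  set m := s.sup id + t.sup id + 1
  have hs : ∀ x ∈ s, x < m := fun x hx => by
    have := Finset.le_sup (f := id) hx
    simp only [id] at this
    omega
  have ht : ∀ x ∈ t, x < m := fun x hx => by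
    have := Finset.le_sup (f := id) hx
    simp only [id] at this
    omega
  -- With `m` above all elements of `s` and `t`, `f` exchanges the blocks `[0, m)` and `[m, 2m)`.
  let f : ℕ → ℕ := fun x => if x < m then x + m else if x < 2 * m then x - m else x
  have hf : Function.Involutive f := by
    intro x
    simp only [f]
    split_ifs <;> omega
  refine ⟨hf.toPerm f, fun x hx hxt => ?_⟩
  have h1 := ht _ hxt
  have h2 := hs x hx
  simp only [Function.Involutive.coe_toPerm, f, h2, if_true] at h1
  omega

theorem Clause.exists_fresh_variant (C : Clause L) (t : Finset ℕ) :
    ∃ K, C.IsVariant K ∧ Disjoint K.vars t := by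
  obtain ⟨π, hπ⟩ := exists_perm_disjoint C.vars t
  refine ⟨_, ⟨π, rfl⟩, Finset.disjoint_left.2 fun y hy => ?_⟩
  rw [Clause.mem_vars, Clause.lits_subst, occursIn_map_subst] at hy
  obtain ⟨x, hx, hy⟩ := hy
  simp only [Term.varFinset, Finset.mem_singleton] at hy
  exact hy ▸ hπ x (Clause.mem_vars.2 hx)

/-! ## Most general unifiers of atoms -/

/-- A unifier of `A` and `B` that is absorbed by all unifiers, moves only variables of `A` and `B`
and introduces only variables of `A` and `B` and function symbols in `S`. -/
structure IsStrongMgu (S : Set (Σ n, L.Functions n)) (A B : Atom L) (θ : Subst L) : Prop where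
  unifies : A.subst θ = B.subst θ
  absorb : ∀ σ : Subst L, A.subst σ = B.subst σ → ∀ x, (θ x).subst σ = σ x
  support : ∀ x, x ∉ A.vars ∪ B.vars → θ x = Term.var x
  range : ∀ x ∈ A.vars ∪ B.vars, (θ x).varFinset ⊆ A.vars ∪ B.vars
  funcs : ∀ x, LogicProg.FuncsIn S (θ x)

theorem exists_isStrongMgu {S : Set (Σ n, L.Functions n)} {A B : Atom L} {σ : Subst L}
    (h : A.subst σ = B.subst σ) (hA : A.FuncsIn S) (hB : B.FuncsIn S) :
    ∃ θ, IsStrongMgu S A B θ := by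
  obtain ⟨n, p, a⟩ := A
  obtain ⟨m, q, b⟩ := B
  have h' := h
  simp only [Atom.subst, Atom.mk.injEq] at h'
  obtain ⟨rfl, hpq, -⟩ := h'
  obtain rfl := eq_of_heq hpq
  set V : Finset ℕ := (Atom.mk n p a).vars ∪ (Atom.mk n p b).vars with hV
  have key : ∀ τ : Subst L, Solves (List.ofFn fun i => (a i, b i)) τ ↔
      (Atom.mk n p a).subst τ = (Atom.mk n p b).subst τ := by
    intro τ
    simp [Solves, Atom.subst, List.mem_ofFn, funext_iff]
  obtain ⟨θ, hθ⟩ := exists_isSolved (V : Set ℕ) S σ _ (List.ofFn fun i => (a i, b i)) le_rfl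
    (by
      intro e he
      obtain ⟨i, rfl⟩ := List.mem_ofFn.1 he
      refine ⟨⟨fun y hy => ?_, hA i⟩, fun y hy => ?_, hB i⟩
      · exact Finset.mem_coe.2 (Finset.mem_union_left _ (Atom.mem_vars.2 ⟨i, hy⟩))
      · exact Finset.mem_coe.2 (Finset.mem_union_right _ (Atom.mem_vars.2 ⟨i, hy⟩)))
    ((key σ).2 h)
  exact ⟨θ, (key θ).1 hθ.solves, fun τ hτ => hθ.absorb τ ((key τ).2 hτ),
    fun x hx => hθ.support x hx, fun x hx => by exact_mod_cast hθ.range x hx, hθ.funcs⟩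

theorem IsStrongMgu.idempotent {S : Set (Σ n, L.Functions n)} {A B : Atom L} {θ : Subst L}
    (h : IsStrongMgu S A B θ) (x : ℕ) : (θ x).subst θ = θ x :=
  h.absorb θ h.unifies x

theorem eq_var_of_idempotent {θ : Subst L} (h : ∀ x, (θ x).subst θ = θ x) {x y : ℕ}
    (hy : y ∈ (θ x).varFinset) : θ y = Term.var y :=
  (subst_eq_self_iff _ _).1 (h x) y hy

/-- A strong mgu need not respect the preferences among variables. It is corrected by choosing, in
the class of variables sent to `y`, a preferred representative `r y`. All unifiers agree on such a
class, so the corrected substitution is still absorbed by every unifier. -/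
theorem exists_isModedMgu (I : Finset ℕ) {A B : Atom L} {σ : Subst L}
    (h : A.subst σ = B.subst σ) : ∃ θ, IsModedMgu I A B θ := by
  classical
  have univ_in : ∀ t : L.Term ℕ, LogicProg.FuncsIn Set.univ t := by
    intro t
    induction t with
    | var => trivial
    | func f ts ih => exact ⟨trivial, ih⟩
  obtain ⟨θ, hθ⟩ := exists_isStrongMgu (S := Set.univ) h (fun i => univ_in _) fun i => univ_in _
  -- Order of preference: input variables of the goal atom, other variables of the goal atom, then
  -- `y` itself.
  let r : ℕ → ℕ := fun y =>
    if h : ∃ x, (x ∈ A.vars ∧ x ∈ I) ∧ θ x = Term.var y then h.choose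
    else if h : ∃ x, x ∈ A.vars ∧ θ x = Term.var y then h.choose else y
  have r_spec : ∀ y, θ y = Term.var y → θ (r y) = Term.var y := by
    intro y hy
    simp only [r]
    split_ifs with h1 h2
    · exact h1.choose_spec.2
    · exact h2.choose_spec.2
    · exact hy
  have r_mem : ∀ y ∈ A.vars ∪ B.vars, r y ∈ A.vars ∪ B.vars := by
    intro y hy
    simp only [r]
    split_ifs with h1 h2
    · exact Finset.mem_union_left _ h1.choose_spec.1.1
    · exact Finset.mem_union_left _ h2.choose_spec.1
    · exact hy
  have r_goal : ∀ x y, x ∈ A.vars → θ x = Term.var y → r y ∈ A.vars := by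
    intro x y hx hxy
    simp only [r]
    split_ifs with h1 h2
    · exact h1.choose_spec.1.1
    · exact h2.choose_spec.1
    · exact absurd ⟨x, hx, hxy⟩ h2
  have r_input : ∀ x y, x ∈ A.vars → x ∈ I → θ x = Term.var y → r y ∈ I := by
    intro x y hx hxI hxy
    simp only [r]
    split_ifs with h1 h2
    · exact h1.choose_spec.1.2
    · exact absurd ⟨x, ⟨hx, hxI⟩, hxy⟩ h1
    · exact absurd ⟨x, ⟨hx, hxI⟩, hxy⟩ h1
  let θ' : Subst L := fun x =>
    if x ∈ A.vars ∪ B.vars then (θ x).subst fun y => Term.var (r y) else Term.var x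
  have θ'_in : ∀ x ∈ A.vars ∪ B.vars, θ' x = (θ x).subst fun y => Term.var (r y) :=
    fun x hx => if_pos hx
  have unif : A.subst θ' = B.subst θ' := by
    rw [(A.subst_eq_subst_iff θ' fun x => (θ x).subst fun y => Term.var (r y)).2
        fun x hx => θ'_in x (Finset.mem_union_left _ hx),
      (B.subst_eq_subst_iff θ' fun x => (θ x).subst fun y => Term.var (r y)).2
        fun x hx => θ'_in x (Finset.mem_union_right _ hx),
      ← Atom.subst_subst, ← Atom.subst_subst, hθ.unifies]
  have absorb : ∀ τ : Subst L, A.subst τ = B.subst τ → ∀ x, (θ' x).subst τ = τ x := by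
    intro τ hτ x
    simp only [θ']
    split_ifs with hx
    · rw [subst_subst, ← hθ.absorb τ hτ x]
      refine subst_congr fun y hy => ?_
      have := r_spec y (eq_var_of_idempotent hθ.idempotent hy)
      have h2 := hθ.absorb τ hτ (r y)
      rw [this] at h2
      exact h2.symm
    · rfl
  have var_of : ∀ x ∈ A.vars, ∀ z, θ' x = Term.var z → ∃ y, θ x = Term.var y ∧ r y = z := by
    intro x hx z hz
    rw [θ'_in x (Finset.mem_union_left _ hx)] at hz
    cases hxy : θ x with
    | var y =>
      rw [hxy] at hz
      exact ⟨y, rfl, by simpa [Term.subst] using hz⟩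
    | func f ts => rw [hxy] at hz; simp [Term.subst] at hz
  refine ⟨θ', ⟨unif, fun τ hτ => ⟨τ, fun x => (absorb τ hτ x).symm⟩⟩, fun x => absorb θ' unif x,
    fun x hx => if_neg hx, ?_, ?_, ?_⟩
  · intro x hx z hz
    rw [θ'_in x hx, mem_varFinset_subst] at hz
    obtain ⟨y, hy, hz⟩ := hz
    simp only [Term.varFinset, Finset.mem_singleton] at hz
    exact hz ▸ r_mem y (hθ.range x hx hy)
  · intro x hx z hz
    obtain ⟨y, hy, rfl⟩ := var_of x hx z hz
    exact r_goal x y hx hy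
  · intro x hx hxI z hz
    obtain ⟨y, hy, rfl⟩ := var_of x hx z hz
    exact r_input x y hx hxI hy

/-- An arbitrary mgu is not produced by the algorithm, but a strong mgu `τ` over the symbols in `S`
factors through it. A function symbol of `θ x` therefore also occurs in `τ x`. -/
theorem IsModedMgu.funcsIn {S : Set (Σ n, L.Functions n)} {I : Finset ℕ} {A B : Atom L}
    {θ : Subst L} (h : IsModedMgu I A B θ) (hA : A.FuncsIn S) (hB : B.FuncsIn S) (x : ℕ) :
    LogicProg.FuncsIn S (θ x) := by
  obtain ⟨τ, hτ⟩ := exists_isStrongMgu h.isMgu.1 hA hB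
  obtain ⟨δ, hδ⟩ := h.isMgu.2 τ hτ.unifies
  exact ((funcsIn_subst S _ _).1 (hδ x ▸ hτ.funcs x)).1

/-! ## Instances of goals at their input variables -/

/-- `γ` maps the variables in `I` to ground terms, and `ls'` is a variant of the instance of `ls`
under `γ`. -/
structure IsInputInstance (I : Finset ℕ) (γ : Subst L) (ls ls' : List (Literal L)) : Prop where
  ground : ∀ x ∈ I, (γ x).varFinset = ∅
  outside : ∀ x ∉ I, γ x = Term.var x
  fwd : ∃ σ : Subst L, (∀ x ∈ I, σ x = γ x) ∧ ls.map (Literal.subst σ) = ls'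
  bwd : ∃ ρ : Subst L, ls'.map (Literal.subst ρ) = ls.map (Literal.subst γ)

/-- Both halves of the relation are equalities of instances of `ls` and `ls'`. It thus passes to any
pair of lists for which such equalities follow, for example tails. -/
theorem IsInputInstance.mono {I : Finset ℕ} {γ : Subst L} {ls ls' ms ms' : List (Literal L)}
    (h : IsInputInstance I γ ls ls')
    (hsub : ∀ σ τ : Subst L, ls.map (Literal.subst σ) = ls'.map (Literal.subst τ) →
      ms.map (Literal.subst σ) = ms'.map (Literal.subst τ)) : IsInputInstance I γ ms ms' := by
  obtain ⟨σ, h1, h2⟩ := h.fwd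
  obtain ⟨ρ, h3⟩ := h.bwd
  refine ⟨h.ground, h.outside, ⟨σ, h1, ?_⟩, ρ, (hsub _ _ h3.symm).symm⟩
  have := hsub σ Term.var (by rw [map_subst_var, h2])
  rwa [map_subst_var] at this

/-- Without input variables the relation means that each list is an instance of the other, that is,
that they are variants. -/
theorem IsInputInstance.symm {γ : Subst L} {ls ls' : List (Literal L)}
    (h : IsInputInstance ∅ γ ls ls') : IsInputInstance ∅ Term.var ls' ls := by
  have hγ : γ = Term.var := funext fun x => h.outside x (by simp)
  obtain ⟨σ, -, h2⟩ := h.fwd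
  obtain ⟨ρ, h3⟩ := h.bwd
  rw [hγ, map_subst_var] at h3
  exact ⟨by simp, by simp, ⟨ρ, by simp, h3⟩, σ, by rw [h2, map_subst_var]⟩

theorem IsInputInstance.refl (ls : List (Literal L)) : IsInputInstance ∅ Term.var ls ls :=
  ⟨by simp, by simp, ⟨Term.var, by simp, map_subst_var _⟩, Term.var, by simp [map_subst_var]⟩

/-- The relation extends to the literals of fresh variants of a clause. -/
theorem IsInputInstance.extend {I U U' : Finset ℕ} {γ : Subst L} {A A' : Atom L}
    {ls ls' : List (Literal L)} {C K K' : Clause L}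
    (h : IsInputInstance I γ (.pos A :: ls) (.pos A' :: ls')) (hI : I ⊆ U)
    (hU : ∀ x, OccursIn x (.pos A :: ls) → x ∈ U)
    (hU' : ∀ x, OccursIn x (.pos A' :: ls') → x ∈ U')
    (hK : C.IsVariant K) (hK' : C.IsVariant K') (hKU : Disjoint K.vars U)
    (hKU' : Disjoint K'.vars U') :
    IsInputInstance I γ (.pos A :: .pos K.head :: (K.body ++ ls))
      (.pos A' :: .pos K'.head :: (K'.body ++ ls')) := by
  obtain ⟨r, r', hr, hr'⟩ := hK.exists_rename hK'
  obtain ⟨σ, h1, h2⟩ := h.fwd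
  obtain ⟨ρ, h3⟩ := h.bwd
  have hmem : ∀ x, OccursIn x K.lits → x ∉ U := fun x hx =>
    Finset.disjoint_left.1 hKU (Clause.mem_vars.2 hx)
  have hmem' : ∀ x, OccursIn x K'.lits → x ∉ U' := fun x hx =>
    Finset.disjoint_left.1 hKU' (Clause.mem_vars.2 hx)
  -- Freshness makes the gluing consistent: the old substitution acts on used variables, the
  -- renaming of the clause on all others.
  refine ⟨h.ground, h.outside, ⟨fun x => if x ∈ U then σ x else Term.var (r x), ?_, ?_⟩,
    fun x => if x ∈ U' then ρ x else Term.var (r' x), ?_⟩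
  · intro x hx
    simp [hI hx, h1 x hx]
  · have e1 := (map_subst_eq_iff (σ := fun x => if x ∈ U then σ x else Term.var (r x))
      (τ := σ)).2 fun x hx => if_pos (hU x hx)
    have e2 := (map_subst_eq_iff (σ := fun x => if x ∈ U then σ x else Term.var (r x))
      (τ := fun x => Term.var (r x))).2 fun x hx => if_neg (hmem x hx)
    rw [h2] at e1
    rw [hr] at e2
    simp only [Clause.lits, List.map_cons, List.cons.injEq] at e1 e2
    simp only [List.map_cons, List.map_append, e1, e2]
  · have e1 := (map_subst_eq_iff (σ := fun x => if x ∈ U' then ρ x else Term.var (r' x))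
      (τ := ρ)).2 fun x hx => if_pos (hU' x hx)
    have e2 := (map_subst_eq_iff (σ := fun x => if x ∈ U' then ρ x else Term.var (r' x))
      (τ := fun x => Term.var (r' x))).2 fun x hx => if_neg (hmem' x hx)
    have e3 : K.lits.map (Literal.subst γ) = K.lits.map (Literal.subst Term.var) :=
      map_subst_eq_iff.2 fun x hx => h.outside x fun hxI => hmem x hx (hI hxI)
    rw [map_subst_var] at e3
    rw [h3] at e1
    rw [hr', ← e3] at e2
    simp only [Clause.lits, List.map_cons, List.cons.injEq] at e1 e2
    simp only [List.map_cons, List.map_append, e1, e2]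

/-- Unifiers of the instances give unifiers of the original atoms. -/
theorem IsInputInstance.unifiable_of_instance {I : Finset ℕ} {γ : Subst L} {A B A' B' : Atom L}
    {ls ls' : List (Literal L)}
    (h : IsInputInstance I γ (.pos A :: .pos B :: ls) (.pos A' :: .pos B' :: ls')) {θ' : Subst L}
    (hθ' : A'.subst θ' = B'.subst θ') :
    ∃ σ : Subst L, A.subst σ = B.subst σ ∧ (∀ x ∈ I, σ x = γ x) ∧
      ls.map (Literal.subst σ) = ls'.map (Literal.subst θ') := by
  obtain ⟨σ, h1, h2⟩ := h.fwd
  simp only [List.map_cons, List.cons.injEq, Literal.subst, Literal.pos.injEq] at h2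
  obtain ⟨hA, hB, hls⟩ := h2
  refine ⟨fun x => (σ x).subst θ', ?_, fun x hx => ?_, ?_⟩
  · rw [← Atom.subst_subst, ← Atom.subst_subst, hA, hB, hθ']
  · simp only [h1 x hx]
    exact subst_eq_self_of_ground (h.ground x hx) _
  · rw [← map_subst_subst, hls]

/-- Unifiers that are compatible with `γ` give unifiers of the instances. -/
theorem IsInputInstance.unifiable_instance {I : Finset ℕ} {γ γ₁ : Subst L} {A B A' B' : Atom L}
    {ls ls' : List (Literal L)}
    (h : IsInputInstance I γ (.pos A :: .pos B :: ls) (.pos A' :: .pos B' :: ls')) {θ : Subst L}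
    (hθ : A.subst θ = B.subst θ) (hγ : ∀ x ∈ I, γ x = (θ x).subst γ₁) :
    ∃ σ : Subst L, A'.subst σ = B'.subst σ ∧
      ls'.map (Literal.subst σ) = (ls.map (Literal.subst θ)).map (Literal.subst γ₁) := by
  obtain ⟨ρ, h3⟩ := h.bwd
  simp only [List.map_cons, List.cons.injEq, Literal.subst, Literal.pos.injEq] at h3
  obtain ⟨hA, hB, hls⟩ := h3
  -- Compatibility says that applying `γ` first changes nothing: `γθγ₁ = θγ₁`.
  have key : (fun x => (γ x).subst fun y => (θ y).subst γ₁) = fun x => (θ x).subst γ₁ := by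
    funext x
    by_cases hx : x ∈ I
    · rw [subst_eq_self_of_ground (h.ground x hx), hγ x hx]
    · rw [h.outside x hx]
      rfl
  refine ⟨fun x => (ρ x).subst fun y => (θ y).subst γ₁, ?_, ?_⟩
  · rw [← Atom.subst_subst A' ρ, ← Atom.subst_subst B' ρ, hA, hB, Atom.subst_subst,
      Atom.subst_subst, key, ← Atom.subst_subst, ← Atom.subst_subst, hθ]
  · rw [← map_subst_subst, hls, map_subst_subst, map_subst_subst, key]

/-- The input variables after a step with substitution `θ`. -/
def nextInputs (I : Finset ℕ) (θ : Subst L) : Finset ℕ :=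
  I ∪ I.biUnion fun x => (θ x).varFinset

theorem mem_nextInputs {I : Finset ℕ} {θ : Subst L} {y : ℕ} :
    y ∈ nextInputs I θ ↔ y ∈ I ∨ ∃ x ∈ I, y ∈ (θ x).varFinset := by
  simp [nextInputs]

/-- The instantiation of the input variables after a step that is lifted. -/
theorem IsInputInstance.exists_next {I : Finset ℕ} {γ : Subst L} {A B A' B' : Atom L}
    {ls ls' : List (Literal L)}
    (h : IsInputInstance I γ (.pos A :: .pos B :: ls) (.pos A' :: .pos B' :: ls')) {θ θ' : Subst L}
    (hθ : IsMgu A B θ) (hid : ∀ x, (θ x).subst θ = θ x) (hθ' : A'.subst θ' = B'.subst θ') :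
    ∃ γ₁ : Subst L, (∀ x ∈ nextInputs I θ, (γ₁ x).varFinset = ∅) ∧
      (∀ x ∉ nextInputs I θ, γ₁ x = Term.var x) ∧ (∀ x ∈ I, γ₁ x = γ x) ∧
      ∀ x ∈ I, γ x = (θ x).subst γ₁ := by
  classical
  obtain ⟨σ, hσ, hσI, -⟩ := h.unifiable_of_instance hθ'
  obtain ⟨δ, hδ⟩ := hθ.2 σ hσ
  have hδI : ∀ x ∈ I, ∀ y ∈ (θ x).varFinset, (δ y).varFinset = ∅ := by
    intro x hx y hy
    refine Finset.eq_empty_of_forall_notMem fun z hz => ?_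
    have : z ∈ ((θ x).subst δ).varFinset := (mem_varFinset_subst _ _ _).2 ⟨y, hy, hz⟩
    rw [← hδ x, hσI x hx, h.ground x hx] at this
    simp at this
  -- Old input variables keep their value, even when they have just been bound; new ones take theirs
  -- from the factor `δ` of the unifier `σ = θδ`. The two prescriptions agree on an old variable
  -- occurring in some `θ x`, since idempotence makes it a fixed point of `θ`.
  refine ⟨fun y => if y ∈ I then γ y else if y ∈ nextInputs I θ then δ y else Term.var y,
    fun y hy => ?_, fun y hy => ?_, fun y hy => if_pos hy, fun x hx => ?_⟩
  · simp only
    split_ifs with hyI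
    · exact h.ground y hyI
    · obtain hyI' | ⟨x, hx, hy⟩ := mem_nextInputs.1 hy
      · exact absurd hyI' hyI
      · exact hδI x hx y hy
  · have : y ∉ I := fun hyI => hy (mem_nextInputs.2 (Or.inl hyI))
    simp [this, hy]
  · rw [← hσI x hx, hδ x]
    refine subst_congr fun y hy => ?_
    have hy1 : y ∈ nextInputs I θ := mem_nextInputs.2 (Or.inr ⟨x, hx, hy⟩)
    by_cases hyI : y ∈ I
    · have := hδ y
      rw [eq_var_of_idempotent hid hy, hσI y hyI] at this
      simpa [hyI] using this.symm
    · simp [hyI, hy1]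

/-- Each mgu is compared with a unifier obtained from the other side. The factor through `θ` carries
the new moded goal to the new instance; the factor through `θ'` carries the new instance back to the
moded goal under `γ₁`. -/
theorem IsInputInstance.next {I : Finset ℕ} {γ γ₁ : Subst L} {A B A' B' : Atom L}
    {ls ls' : List (Literal L)}
    (h : IsInputInstance I γ (.pos A :: .pos B :: ls) (.pos A' :: .pos B' :: ls')) {θ θ' : Subst L}
    (hθ : IsMgu A B θ) (hid : ∀ x, (θ x).subst θ = θ x) (hθ' : IsMgu A' B' θ')
    (hground : ∀ x ∈ nextInputs I θ, (γ₁ x).varFinset = ∅)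
    (hout : ∀ x ∉ nextInputs I θ, γ₁ x = Term.var x) (hγ : ∀ x ∈ I, γ x = (θ x).subst γ₁) :
    IsInputInstance (nextInputs I θ) γ₁ (ls.map (Literal.subst θ)) (ls'.map (Literal.subst θ')) := by
  classical
  obtain ⟨σ, hσ, hσI, hls⟩ := h.unifiable_of_instance hθ'.1
  obtain ⟨δ, hδ⟩ := hθ.2 σ hσ
  obtain ⟨τ, hτ, hls'⟩ := h.unifiable_instance hθ.1 hγ
  obtain ⟨ε, hε⟩ := hθ'.2 τ hτ
  refine ⟨hground, hout, ⟨fun y => if y ∈ nextInputs I θ then γ₁ y else δ y,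
    fun x hx => if_pos hx, ?_⟩, ε, ?_⟩
  · rw [← hls, map_subst_subst, map_subst_eq_iff]
    intro x _
    rw [hδ x]
    refine subst_congr fun y hy => ?_
    -- The factor `δ` already agrees with `γ₁` on the new input variables occurring in the range of
    -- `θ`, so overwriting it there is harmless.
    split_ifs with hy1
    · obtain hyI | ⟨z, hz, hyz⟩ := mem_nextInputs.1 hy1
      · have h1 := hδ y
        have h2 := hγ y hyI
        rw [eq_var_of_idempotent hid hy] at h1 h2
        rw [hσI y hyI] at h1
        exact h2.symm.trans h1
      · refine (subst_eq_subst_iff (θ z) γ₁ δ).1 ?_ y hyz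
        rw [← hγ z hz, ← hδ z, hσI z hz]
    · rfl
  · rw [← hls', map_subst_subst, map_subst_eq_iff]
    exact fun x _ => (hε x).symm

/-! ## Resolvents -/

/-- The literals of the goal of a node. -/
def Node.lits (N : Node L) : List (Literal L) := N.goal.map Subgoal.lit

/-- The variables of the goal have been recorded. -/
def Node.Closed (N : Node L) : Prop := ∀ x, OccursIn x N.lits → x ∈ N.used

theorem Node.resolvent_eq_some {R : ResolutionRule L} {P : Program L} {N N₁ : Node L} {k : ℕ}
    {θ : Subst L} : N.resolvent R P k = some (θ, N₁) ↔
      ∃ A anc rest C K, N.goal = ⟨.pos A, anc⟩ :: rest ∧ P[k]? = some C ∧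
        R.resolve N A C = some (K, θ) ∧
        N₁ = { path := N.path ++ [Edge.clause k]
               goal := (K.body.map fun l => ⟨l.subst θ, insert N.depth anc⟩) ++
                 rest.map fun s => ⟨s.lit.subst θ, s.anc⟩
               used := N.used ∪ K.vars
               inputs := nextInputs N.inputs θ } := by
  unfold Node.resolvent
  split
  · next A anc rest C hg hC =>
    simp only [Option.map_eq_some_iff, Prod.mk.injEq, hg, hC]
    constructor
    · rintro ⟨⟨K, θ'⟩, hr, rfl, rfl⟩
      exact ⟨A, anc, rest, C, K, rfl, rfl, hr, rfl⟩
    · rintro ⟨A', anc', rest', C', K, hg', hC', hr, rfl⟩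
      simp only [List.cons.injEq, Subgoal.mk.injEq, Literal.pos.injEq, Option.some.injEq] at hg' hC'
      obtain ⟨⟨rfl, rfl⟩, rfl⟩ := hg'
      subst hC'
      exact ⟨(K, θ), hr, rfl, rfl⟩
  · next hne =>
    simp only [reduceCtorEq, false_iff]
    rintro ⟨A, anc, rest, C, K, hg, hC, -⟩
    exact hne A anc rest C hg hC

/-- Unifiability with one fresh variant forces the rule to resolve, though possibly with another
variant. The variant actually chosen therefore has to be matched afterwards. -/
theorem ResolutionRule.exists_resolve (R : ResolutionRule L) {N : Node L} {A : Atom L}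
    {C K : Clause L} {σ : Subst L} (hK : C.IsVariant K) (hd : Disjoint K.vars N.used)
    (hσ : A.subst σ = K.head.subst σ) : ∃ K' θ, R.resolve N A C = some (K', θ) := by
  obtain ⟨θ, hθ⟩ := exists_isModedMgu N.inputs hσ
  cases h : R.resolve N A C with
  | none => exact absurd ⟨hK, hd, hθ⟩ (R.complete N A C h K θ)
  | some r => exact ⟨r.1, r.2, rfl⟩

theorem lits_resolvent (ls : List (Literal L)) (rest : List (Subgoal L)) (θ : Subst L)
    (a : Finset ℕ) :
    List.map Subgoal.lit ((ls.map fun l => ⟨l.subst θ, a⟩) ++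
      rest.map fun s => ⟨s.lit.subst θ, s.anc⟩) =
      (ls ++ rest.map Subgoal.lit).map (Literal.subst θ) := by
  simp [Function.comp_def]

theorem Node.lits_of_goal {N : Node L} {l : Literal L} {anc : Finset ℕ} {rest : List (Subgoal L)}
    (h : N.goal = ⟨l, anc⟩ :: rest) : N.lits = l :: rest.map Subgoal.lit := by
  simp [Node.lits, h]

theorem Node.Closed.resolvent {R : ResolutionRule L} {P : Program L} {N N₁ : Node L} {k : ℕ}
    {θ : Subst L} (h : N.Closed) (hr : N.resolvent R P k = some (θ, N₁)) : N₁.Closed := by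
  obtain ⟨A, anc, rest, C, K, hg, hC, hres, rfl⟩ := Node.resolvent_eq_some.1 hr
  obtain ⟨-, -, hm⟩ := R.sound _ _ _ _ _ hres
  rw [Node.Closed, Node.lits_of_goal hg] at h
  intro y hy
  simp only [Node.lits] at hy
  rw [lits_resolvent, occursIn_map_subst] at hy
  obtain ⟨x, hx, hy⟩ := hy
  have hA : A.vars ⊆ N.used := fun z hz => h z (occursIn_cons.2 (Or.inl hz))
  have hB : K.head.vars ⊆ K.vars := fun z hz => Clause.mem_vars.2 (occursIn_cons.2 (Or.inl hz))
  by_cases hxAB : x ∈ A.vars ∪ K.head.vars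
  · exact Finset.union_subset_union hA hB (hm.range x hxAB hy)
  · rw [hm.support x hxAB] at hy
    simp only [Term.varFinset, Finset.mem_singleton] at hy
    rw [hy]
    obtain hx | hx := occursIn_append.1 hx
    · exact Finset.mem_union_right _ (Clause.mem_vars.2 (occursIn_cons.2 (Or.inr hx)))
    · exact Finset.mem_union_left _ (h x (occursIn_cons.2 (Or.inr hx)))

/-- A step of a derivation, performed on an instance of the goal. -/
theorem IsInputInstance.resolvent {R R' : ResolutionRule L} {P : Program L} {N N₁ N' : Node L}
    {I : Finset ℕ} {γ γ₁ θ : Subst L} {k : ℕ} (h : IsInputInstance I γ N.lits N'.lits)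
    (hI : I ⊆ N.used) (hN : N.Closed) (hN' : N'.Closed)
    (hr : N.resolvent R P k = some (θ, N₁))
    (hground : ∀ x ∈ nextInputs I θ, (γ₁ x).varFinset = ∅)
    (hout : ∀ x ∉ nextInputs I θ, γ₁ x = Term.var x) (hγ : ∀ x ∈ I, γ x = (θ x).subst γ₁) :
    ∃ θ' N₁', N'.resolvent R' P k = some (θ', N₁') ∧
      IsInputInstance (nextInputs I θ) γ₁ N₁.lits N₁'.lits := by
  obtain ⟨A, anc, rest, C, K, hg, hC, hres, rfl⟩ := Node.resolvent_eq_some.1 hr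
  obtain ⟨hCK, hd, hm⟩ := R.sound _ _ _ _ _ hres
  rw [Node.Closed, Node.lits_of_goal hg] at hN
  rw [Node.lits_of_goal hg] at h
  obtain ⟨σ, -, hσ⟩ := h.fwd
  simp only [List.map_cons, Literal.subst] at hσ
  obtain ⟨⟨l, anc'⟩, rest', hg', hl, -⟩ := List.map_eq_cons_iff.1 hσ.symm
  simp only at hl
  subst hl
  rw [Node.Closed, Node.lits_of_goal hg'] at hN'
  rw [Node.lits_of_goal hg'] at h
  -- The variant `K₀` only shows that `R'` does not skip the clause; the comparison of goals below
  -- uses the variant `K'` chosen by `R'`.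
  obtain ⟨K₀, hCK₀, hd₀⟩ := C.exists_fresh_variant N'.used
  obtain ⟨τ, hτ, -⟩ := (h.extend hI hN hN' hCK hCK₀ hd hd₀).unifiable_instance hm.isMgu.1 hγ
  obtain ⟨K', θ', hr'⟩ := R'.exists_resolve hCK₀ hd₀ hτ
  obtain ⟨hCK', hd', hm'⟩ := R'.sound _ _ _ _ _ hr'
  refine ⟨θ', _, Node.resolvent_eq_some.2 ⟨_, anc', rest', C, K', hg', hC, hr', rfl⟩, ?_⟩
  have := (h.extend hI hN hN' hCK hCK' hd hd').next hm.isMgu hm.idempotent hm'.isMgu hground hout hγ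
  simp only [Node.lits]
  rwa [lits_resolvent, lits_resolvent]

/-- A step of a derivation for an instance of a goal, lifted to the goal. -/
theorem IsInputInstance.lift_resolvent {R R' : ResolutionRule L} {P : Program L}
    {N N' N₁' : Node L} {I : Finset ℕ} {γ θ' : Subst L} {k : ℕ}
    (h : IsInputInstance I γ N.lits N'.lits)
    (hI : I ⊆ N.used) (hN : N.Closed) (hN' : N'.Closed)
    (hr : N'.resolvent R' P k = some (θ', N₁')) :
    ∃ θ N₁ γ₁, N.resolvent R P k = some (θ, N₁) ∧
      IsInputInstance (nextInputs I θ) γ₁ N₁.lits N₁'.lits ∧ (∀ x ∈ I, γ₁ x = γ x) ∧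
      ∀ x ∈ I, γ x = (θ x).subst γ₁ := by
  obtain ⟨A', anc', rest', C, K', hg', hC, hr', rfl⟩ := Node.resolvent_eq_some.1 hr
  obtain ⟨hCK', hd', hm'⟩ := R'.sound _ _ _ _ _ hr'
  rw [Node.Closed, Node.lits_of_goal hg'] at hN'
  rw [Node.lits_of_goal hg'] at h
  obtain ⟨σ, -, hσ⟩ := h.fwd
  obtain ⟨l, ls, hl, hlA, -⟩ := List.map_eq_cons_iff.1 hσ
  obtain ⟨⟨l', anc⟩, rest, hg, rfl, -⟩ := List.map_eq_cons_iff.1 hl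
  obtain ⟨A, rfl⟩ : ∃ A, l' = .pos A := by
    cases l' with
    | pos A => exact ⟨A, rfl⟩
    | neg A => simp [Literal.subst] at hlA
  rw [Node.Closed, Node.lits_of_goal hg] at hN
  rw [Node.lits_of_goal hg] at h
  obtain ⟨K₀, hCK₀, hd₀⟩ := C.exists_fresh_variant N.used
  obtain ⟨τ, hτ, -⟩ := (h.extend hI hN hN' hCK₀ hCK' hd₀ hd').unifiable_of_instance hm'.isMgu.1
  obtain ⟨K, θ, hr⟩ := R.exists_resolve hCK₀ hd₀ hτ
  obtain ⟨hCK, hd, hm⟩ := R.sound _ _ _ _ _ hr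
  have hext := h.extend hI hN hN' hCK hCK' hd hd'
  obtain ⟨γ₁, h1, h2, h3, h4⟩ := hext.exists_next hm.isMgu hm.idempotent hm'.isMgu.1
  refine ⟨θ, _, γ₁, Node.resolvent_eq_some.2 ⟨_, anc, rest, C, K, hg, hC, hr, rfl⟩, ?_, h3, h4⟩
  have := hext.next hm.isMgu hm.idempotent hm'.isMgu h1 h2 h4
  simp only [Node.lits]
  rwa [lits_resolvent, lits_resolvent]

/-! ## Negation arcs -/

theorem Node.negationArc_eq_some {N M : Node L} : N.negationArc = some M ↔
    ∃ A anc rest, N.goal = ⟨.neg A, anc⟩ :: rest ∧ A.IsGround ∧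
      M = { N with path := N.path ++ [Edge.neg], goal := [⟨.pos A, anc⟩] } := by
  unfold Node.negationArc
  split
  · next A anc rest hg =>
    constructor
    · intro h
      split_ifs at h with hA
      exact ⟨A, anc, rest, hg, hA, (Option.some.inj h).symm⟩
    · rintro ⟨A', anc', rest', hg', hA, rfl⟩
      rw [hg] at hg'
      simp only [List.cons.injEq, Subgoal.mk.injEq, Literal.neg.injEq] at hg'
      obtain ⟨⟨rfl, rfl⟩, rfl⟩ := hg'
      rw [if_pos hA]
  · next hne =>
    simp only [reduceCtorEq, false_iff]
    rintro ⟨A, anc, rest, hg, -⟩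
    exact hne A anc rest hg

theorem Node.dropNegative_eq_some {N M : Node L} : N.dropNegative = some M ↔
    ∃ A anc rest, N.goal = ⟨.neg A, anc⟩ :: rest ∧
      M = { N with path := N.path ++ [Edge.naf], goal := rest } := by
  unfold Node.dropNegative
  split
  · next A anc rest hg =>
    constructor
    · intro h
      exact ⟨A, anc, rest, hg, (Option.some.inj h).symm⟩
    · rintro ⟨A', anc', rest', hg', rfl⟩
      rw [hg] at hg'
      simp only [List.cons.injEq] at hg'
      obtain ⟨-, rfl⟩ := hg'
      rfl
  · next hne =>
    simp only [reduceCtorEq, false_iff]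
    rintro ⟨A, anc, rest, hg, -⟩
    exact hne A anc rest hg

theorem Atom.IsGround.map_subst {A : Atom L} (hA : A.IsGround) (σ : Subst L) :
    [Literal.pos A].map (Literal.subst σ) = [.pos A] := by
  simp [Literal.subst, hA.subst_eq]

theorem IsInputInstance.of_ground {I : Finset ℕ} {γ : Subst L} {ls ls' : List (Literal L)}
    (h : IsInputInstance I γ ls ls') {A : Atom L} (hA : A.IsGround) :
    IsInputInstance I γ [.pos A] [.pos A] :=
  h.mono fun σ τ _ => by rw [hA.map_subst, hA.map_subst]

theorem IsInputInstance.exists_neg {I : Finset ℕ} {γ : Subst L} {ls ls' : List (Literal L)}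
    {A' : Atom L} (h : IsInputInstance I γ ls (.neg A' :: ls')) : ∃ A ms, ls = .neg A :: ms := by
  obtain ⟨σ, -, hσ⟩ := h.fwd
  obtain ⟨l, ms, rfl, hl, -⟩ := List.map_eq_cons_iff.1 hσ
  cases l with
  | pos A => simp [Literal.subst] at hl
  | neg A => exact ⟨A, ms, rfl⟩

/-- If the selected subgoal is a ground negative one, then so is the corresponding subgoal. -/
theorem IsInputInstance.selected_neg {I : Finset ℕ} {γ : Subst L} {N N' : Node L} {A : Atom L}
    {anc : Finset ℕ} {rest : List (Subgoal L)} (h : IsInputInstance I γ N.lits N'.lits)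
    (hg : N.goal = ⟨.neg A, anc⟩ :: rest) (hA : A.IsGround) :
    ∃ anc' rest', N'.goal = ⟨.neg A, anc'⟩ :: rest' ∧
      IsInputInstance I γ (rest.map Subgoal.lit) (rest'.map Subgoal.lit) := by
  rw [Node.lits_of_goal hg] at h
  obtain ⟨σ, -, hσ⟩ := h.fwd
  simp only [List.map_cons, Literal.subst, hA.subst_eq] at hσ
  obtain ⟨⟨l, anc'⟩, rest', hg', hl, -⟩ := List.map_eq_cons_iff.1 hσ.symm
  simp only at hl
  subst hl
  rw [Node.lits_of_goal hg'] at h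
  exact ⟨anc', rest', hg', h.mono fun σ τ e => (List.cons.inj e).2⟩

/-! ## Evaluation is invariant under variants -/

theorem Node.closed_of_ground {N : Node L} {A : Atom L} (hA : A.IsGround)
    (h : N.lits = [.pos A]) : N.Closed := by
  rintro x ⟨l, hl, hx⟩
  rw [h, List.mem_singleton] at hl
  subst hl
  rw [Atom.IsGround] at hA
  simp [Literal.atom, hA] at hx

theorem Node.Closed.tail {N M : Node L} {l : Literal L} {anc : Finset ℕ} {rest : List (Subgoal L)}
    (h : N.Closed) (hg : N.goal = ⟨l, anc⟩ :: rest) (hM : M.goal = rest) (hu : M.used = N.used) :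
    M.Closed := by
  intro x hx
  rw [hu]
  refine h x ?_
  rw [Node.lits_of_goal hg, occursIn_cons]
  rw [Node.lits, hM] at hx
  exact Or.inr hx

theorem nextInputs_empty (θ : Subst L) : nextInputs ∅ θ = ∅ := by simp [nextInputs]

theorem IsInputInstance.variant_resolvent {R R' : ResolutionRule L} {P : Program L}
    {N N₁ N' : Node L} {θ : Subst L} {k : ℕ} (h : IsInputInstance ∅ Term.var N.lits N'.lits)
    (hN : N.Closed) (hN' : N'.Closed) (hr : N.resolvent R P k = some (θ, N₁)) :
    ∃ θ' N₁', N'.resolvent R' P k = some (θ', N₁') ∧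
      IsInputInstance ∅ Term.var N₁.lits N₁'.lits := by
  obtain ⟨θ', N₁', h1, h2⟩ := h.resolvent (R' := R') (γ₁ := Term.var) (by simp) hN hN' hr
    (by simp [nextInputs_empty]) (fun _ _ => rfl) (by simp)
  rw [nextInputs_empty] at h2
  exact ⟨θ', N₁', h1, h2⟩

/-- Evaluation sees a goal only up to renaming, whatever the resolution rules, ancestors and paths.
This lets both trees take the same decisions at negative subgoals and when pruning. -/
theorem Evaluates.of_variant {R R' : ResolutionRule L} {P : Program L} {N : Node L} {o : Outcome}
    (h : Evaluates R P N o) : ∀ N' : Node L, IsInputInstance ∅ Term.var N.lits N'.lits →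
      N.Closed → N'.Closed → Evaluates R' P N' o := by
  have selected : ∀ {N N' M : Node L}, IsInputInstance ∅ Term.var N.lits N'.lits →
      N.negationArc = some M → ∃ M' N₁', N'.negationArc = some M' ∧
        IsInputInstance ∅ Term.var M.lits M'.lits ∧ M.Closed ∧ M'.Closed ∧
        N'.dropNegative = some N₁' ∧ ∀ N₁, N.dropNegative = some N₁ →
          IsInputInstance ∅ Term.var N₁.lits N₁'.lits ∧ (N.Closed → N₁.Closed) ∧
            (N'.Closed → N₁'.Closed) := by
    intro N N' M hv hM
    obtain ⟨A, anc, rest, hg, hA, rfl⟩ := Node.negationArc_eq_some.1 hM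
    obtain ⟨anc', rest', hg', hv'⟩ := hv.selected_neg hg hA
    refine ⟨_, _, Node.negationArc_eq_some.2 ⟨A, anc', rest', hg', hA, rfl⟩, hv.of_ground hA,
      Node.closed_of_ground hA rfl, Node.closed_of_ground hA rfl,
      Node.dropNegative_eq_some.2 ⟨A, anc', rest', hg', rfl⟩, fun N₁ hN₁ => ?_⟩
    obtain ⟨A₂, anc₂, rest₂, hg₂, rfl⟩ := Node.dropNegative_eq_some.1 hN₁
    rw [hg] at hg₂
    obtain ⟨-, rfl⟩ := List.cons.inj hg₂
    exact ⟨hv', fun hc => hc.tail hg rfl rfl, fun hc => hc.tail hg' rfl rfl⟩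
  induction h with
  | leaf N hN =>
    intro N' hv _ _
    obtain ⟨σ, -, hσ⟩ := hv.fwd
    refine .leaf N' ?_
    simpa [Node.lits, hN] using hσ
  | clause_success N N₁ k θ hr _ ih =>
    intro N' hv hN hN'
    obtain ⟨θ', N₁', hr', hv'⟩ := hv.variant_resolvent (R' := R') hN hN' hr
    exact .clause_success N' N₁' k θ' hr' (ih N₁' hv' (hN.resolvent hr) (hN'.resolvent hr'))
  | clause_failure N A anc rest hg _ ih =>
    intro N' hv hN hN'
    have hv₀ := hv
    rw [Node.lits_of_goal hg] at hv
    obtain ⟨σ, -, hσ⟩ := hv.fwd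
    simp only [List.map_cons, Literal.subst] at hσ
    obtain ⟨⟨l, anc'⟩, rest', hg', hl, -⟩ := List.map_eq_cons_iff.1 hσ.symm
    simp only at hl
    subst hl
    -- Finite failure quantifies over all children of `N'`, so each of them is pulled back to a
    -- child of `N` by the symmetric relation.
    refine .clause_failure N' _ anc' rest' hg' fun k θ' N₁' hr' => ?_
    obtain ⟨θ, N₁, hr, hv'⟩ := hv₀.symm.variant_resolvent (R' := R) hN' hN hr'
    exact ih k θ N₁ hr N₁' hv'.symm (hN.resolvent hr) (hN'.resolvent hr')
  | neg_failure N M hM _ ih =>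
    intro N' hv hN hN'
    obtain ⟨M', -, hM', hvM, hc, hc', -⟩ := selected hv hM
    exact .neg_failure N' M' hM' (ih M' hvM hc hc')
  | neg_continue N M N₁ o hM _ hd _ ih₁ ih₂ =>
    intro N' hv hN hN'
    obtain ⟨M', N₁', hM', hvM, hc, hc', hd', hdr⟩ := selected hv hM
    obtain ⟨hv', h1, h2⟩ := hdr N₁ hd
    exact .neg_continue N' M' N₁' o hM' (ih₁ M' hvM hc hc') hd' (ih₂ N₁' hv' (h1 hN) (h2 hN'))

/-! ## Corresponding nodes of two trees -/

/-- The goal of `N'` is a variant of the instance of the goal of `N` under `γ`; behind a negation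
arc the goals are variants of each other. -/
structure Tracks (I : Finset ℕ) (γ : Subst L) (N N' : Node L) : Prop where
  inst : IsInputInstance I γ N.lits N'.lits
  inputs : I ⊆ N.used
  closed : N.Closed
  closed' : N'.Closed
  path : N'.path = N.path
  variant : Edge.neg ∈ N.path → IsInputInstance ∅ Term.var N.lits N'.lits

theorem Node.child_clause {R : ResolutionRule L} {P : Program L} {N N₁ : Node L} {k : ℕ}
    {θ : Subst L} : N.child R P (.clause k) = some (θ, N₁) ↔
      (Edge.neg ∈ N.path → ∀ j < k, ∀ θ M, N.resolvent R P j = some (θ, M) →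
        ¬ Evaluates R P M .success) ∧ N.resolvent R P k = some (θ, N₁) := by
  simp only [Node.child]
  split_ifs with h
  · simp only [false_iff, not_and]
    obtain ⟨h1, j, hj, θ', M, hM, he⟩ := h
    exact fun h' => absurd he (h' h1 j hj θ' M hM)
  · refine ⟨fun hr => ⟨fun h1 j hj θ' M hM he => h ⟨h1, j, hj, θ', M, hM, he⟩, hr⟩, fun h => h.2⟩

theorem Node.child_naf {R : ResolutionRule L} {P : Program L} {N N₁ : Node L}
    {θ : Subst L} : N.child R P .naf = some (θ, N₁) ↔
      ∃ A anc rest, N.goal = ⟨.neg A, anc⟩ :: rest ∧ A.IsGround ∧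
        Evaluates R P { N with path := N.path ++ [Edge.neg], goal := [⟨.pos A, anc⟩] } .failure ∧
        θ = Term.var ∧ N₁ = { N with path := N.path ++ [Edge.naf], goal := rest } := by
  simp only [Node.child]
  split_ifs with h
  · obtain ⟨M, hM, he⟩ := h
    obtain ⟨A, anc, rest, hg, hA, rfl⟩ := Node.negationArc_eq_some.1 hM
    have hd : N.dropNegative = some { N with path := N.path ++ [Edge.naf], goal := rest } :=
      Node.dropNegative_eq_some.2 ⟨A, anc, rest, hg, rfl⟩
    simp only [hd, Option.map_some, Option.some.injEq, Prod.mk.injEq]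
    constructor
    · rintro ⟨rfl, rfl⟩
      exact ⟨A, anc, rest, hg, hA, he, rfl, rfl⟩
    · rintro ⟨A', anc', rest', hg', -, -, rfl, rfl⟩
      rw [hg] at hg'
      obtain ⟨-, rfl⟩ := List.cons.inj hg'
      exact ⟨rfl, rfl⟩
  · simp only [false_iff]
    rintro ⟨A, anc, rest, hg, hA, he, -, -⟩
    exact h ⟨_, Node.negationArc_eq_some.2 ⟨A, anc, rest, hg, hA, rfl⟩, he⟩

theorem Node.child_neg {R : ResolutionRule L} {P : Program L} {N N₁ : Node L}
    {θ : Subst L} : N.child R P .neg = some (θ, N₁) ↔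
      ∃ A anc rest, N.goal = ⟨.neg A, anc⟩ :: rest ∧ A.IsGround ∧ θ = Term.var ∧
        N₁ = { N with path := N.path ++ [Edge.neg], goal := [⟨.pos A, anc⟩] } := by
  simp only [Node.child, Option.map_eq_some_iff, Prod.mk.injEq, Node.negationArc_eq_some]
  constructor
  · rintro ⟨M, ⟨A, anc, rest, hg, hA, rfl⟩, rfl, rfl⟩
    exact ⟨A, anc, rest, hg, hA, rfl, rfl⟩
  · rintro ⟨A, anc, rest, hg, hA, rfl, rfl⟩
    exact ⟨_, ⟨A, anc, rest, hg, hA, rfl⟩, rfl, rfl⟩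

theorem nextInputs_var (I : Finset ℕ) : nextInputs I (Term.var : Subst L) = I := by
  ext y
  simp [mem_nextInputs]

theorem Node.child_path {R : ResolutionRule L} {P : Program L} {N N₁ : Node L} {e : Edge}
    {θ : Subst L} (h : N.child R P e = some (θ, N₁)) : N₁.path = N.path ++ [e] := by
  cases e with
  | clause k =>
    obtain ⟨A, anc, rest, C, K, -, -, -, rfl⟩ := Node.resolvent_eq_some.1 (Node.child_clause.1 h).2
    rfl
  | naf =>
    obtain ⟨A, anc, rest, -, -, -, -, rfl⟩ := Node.child_naf.1 h
    rfl
  | neg =>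
    obtain ⟨A, anc, rest, -, -, -, rfl⟩ := Node.child_neg.1 h
    rfl

theorem Node.child_inputs {R : ResolutionRule L} {P : Program L} {N N₁ : Node L} {e : Edge}
    {θ : Subst L} (h : N.child R P e = some (θ, N₁)) : N₁.inputs = nextInputs N.inputs θ := by
  cases e with
  | clause k =>
    obtain ⟨A, anc, rest, C, K, -, -, -, rfl⟩ := Node.resolvent_eq_some.1 (Node.child_clause.1 h).2
    rfl
  | naf =>
    obtain ⟨A, anc, rest, -, -, -, rfl, rfl⟩ := Node.child_naf.1 h
    rw [nextInputs_var]
  | neg =>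
    obtain ⟨A, anc, rest, -, -, rfl, rfl⟩ := Node.child_neg.1 h
    rw [nextInputs_var]

theorem nextInputs_subset_used {R : ResolutionRule L} {P : Program L} {N N₁ : Node L} {k : ℕ}
    {θ : Subst L} (hN : N.Closed) {I : Finset ℕ} (hI : I ⊆ N.used)
    (hr : N.resolvent R P k = some (θ, N₁)) : nextInputs I θ ⊆ N₁.used := by
  obtain ⟨A, anc, rest, C, K, hg, hC, hres, rfl⟩ := Node.resolvent_eq_some.1 hr
  obtain ⟨-, -, hm⟩ := R.sound _ _ _ _ _ hres
  rw [Node.Closed, Node.lits_of_goal hg] at hN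
  have hA : A.vars ⊆ N.used := fun z hz => hN z (occursIn_cons.2 (Or.inl hz))
  have hB : K.head.vars ⊆ K.vars := fun z hz => Clause.mem_vars.2 (occursIn_cons.2 (Or.inl hz))
  intro y hy
  obtain hy | ⟨x, hx, hy⟩ := mem_nextInputs.1 hy
  · exact Finset.mem_union_left _ (hI hy)
  · by_cases hxAB : x ∈ A.vars ∪ K.head.vars
    · exact Finset.union_subset_union hA hB (hm.range x hxAB hy)
    · rw [hm.support x hxAB] at hy
      simp only [Term.varFinset, Finset.mem_singleton] at hy
      exact Finset.mem_union_left _ (hy ▸ hI hx)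

theorem not_evaluates_of_variant {R R' : ResolutionRule L} {P : Program L} {N N' : Node L} {k : ℕ}
    (hv : IsInputInstance ∅ Term.var N.lits N'.lits) (hN : N.Closed) (hN' : N'.Closed)
    (h : ∀ j < k, ∀ θ M, N.resolvent R P j = some (θ, M) → ¬ Evaluates R P M .success) :
    ∀ j < k, ∀ θ M, N'.resolvent R' P j = some (θ, M) → ¬ Evaluates R' P M .success := by
  intro j hj θ' M' hr' he
  obtain ⟨θ, M, hr, hv'⟩ := hv.symm.variant_resolvent (R' := R) hN' hN hr'
  exact h j hj θ M hr (he.of_variant M hv' (hN'.resolvent hr') (hN.resolvent hr))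

/-- Behind a negation arc the variant relation yields a resolvent of `N'` as well; as the rule fixes
the choice at each node, it is the given one. -/
theorem Tracks.resolvent {R R' : ResolutionRule L} {P : Program L} {I : Finset ℕ}
    {γ γ₁ θ θ' : Subst L} {N N' N₁ N₁' : Node L} {k : ℕ} (h : Tracks I γ N N')
    (hr : N.resolvent R P k = some (θ, N₁)) (hr' : N'.resolvent R' P k = some (θ', N₁'))
    (hinst : IsInputInstance (nextInputs I θ) γ₁ N₁.lits N₁'.lits) :
    Tracks (nextInputs I θ) γ₁ N₁ N₁' := by
  have hpath : ∀ {R : ResolutionRule L} {N N₁ : Node L} {θ : Subst L},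
      N.resolvent R P k = some (θ, N₁) → N₁.path = N.path ++ [.clause k] := by
    intro R N N₁ θ hr
    obtain ⟨A, anc, rest, C, K, -, -, -, rfl⟩ := Node.resolvent_eq_some.1 hr
    rfl
  refine ⟨hinst, nextInputs_subset_used h.closed h.inputs hr, h.closed.resolvent hr,
    h.closed'.resolvent hr', by rw [hpath hr, hpath hr', h.path], fun hneg => ?_⟩
  rw [hpath hr] at hneg
  obtain ⟨θ'', N₁'', hr'', hv⟩ := (h.variant (by simpa using hneg)).variant_resolvent (R' := R')
    h.closed h.closed' hr
  rw [hr'] at hr''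
  simp only [Option.some.injEq, Prod.mk.injEq] at hr''
  rwa [hr''.2]

/-- Pruning occurs only behind a negation arc. There the goals are variants, so the same earlier
clauses lead to success in both trees. -/
theorem Tracks.prune {R R' : ResolutionRule L} {P : Program L} {I : Finset ℕ} {γ : Subst L}
    {N N' : Node L} {k : ℕ} (h : Tracks I γ N N') :
    (Edge.neg ∈ N.path → ∀ j < k, ∀ θ M, N.resolvent R P j = some (θ, M) →
        ¬ Evaluates R P M .success) ↔
      (Edge.neg ∈ N'.path → ∀ j < k, ∀ θ M, N'.resolvent R' P j = some (θ, M) →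
        ¬ Evaluates R' P M .success) := by
  rw [h.path]
  exact ⟨fun hp hneg => not_evaluates_of_variant (h.variant hneg) h.closed h.closed' (hp hneg),
    fun hp hneg => not_evaluates_of_variant (h.variant hneg).symm h.closed' h.closed (hp hneg)⟩

/-- A ground atom is unaffected by substitutions, so both nodes select the same literal. The two
subsidiary roots then differ only in bookkeeping, which evaluation ignores. -/
theorem Tracks.negation {R R' : ResolutionRule L} {P : Program L} {I : Finset ℕ} {γ : Subst L}
    {N N' : Node L} {A : Atom L} {anc : Finset ℕ} {rest : List (Subgoal L)} (h : Tracks I γ N N')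
    (hg : N.goal = ⟨.neg A, anc⟩ :: rest) (hA : A.IsGround) :
    ∃ anc' rest', N'.goal = ⟨.neg A, anc'⟩ :: rest' ∧
      Tracks I γ { N with path := N.path ++ [Edge.naf], goal := rest }
        { N' with path := N'.path ++ [Edge.naf], goal := rest' } ∧
      Tracks I γ { N with path := N.path ++ [Edge.neg], goal := [⟨.pos A, anc⟩] }
        { N' with path := N'.path ++ [Edge.neg], goal := [⟨.pos A, anc'⟩] } ∧
      ∀ o, Evaluates R P { N with path := N.path ++ [Edge.neg], goal := [⟨.pos A, anc⟩] } o ↔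
        Evaluates R' P { N' with path := N'.path ++ [Edge.neg], goal := [⟨.pos A, anc'⟩] } o := by
  obtain ⟨anc', rest', hg', hi⟩ := h.inst.selected_neg hg hA
  refine ⟨anc', rest', hg', ⟨hi, h.inputs, h.closed.tail hg rfl rfl, h.closed'.tail hg' rfl rfl,
    by simp [h.path], fun hneg => ?_⟩, ⟨h.inst.of_ground hA, h.inputs,
      Node.closed_of_ground hA rfl, Node.closed_of_ground hA rfl, by simp [h.path],
      fun _ => .refl _⟩, fun o => ⟨fun he => ?_, fun he => ?_⟩⟩
  · obtain ⟨anc'', rest'', hg'', hi'⟩ :=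
      (h.variant (by simpa using hneg)).selected_neg hg hA
    rw [hg'] at hg''
    obtain ⟨-, rfl⟩ := List.cons.inj hg''
    exact hi'
  · exact he.of_variant _ (.refl [.pos A]) (Node.closed_of_ground hA rfl)
      (Node.closed_of_ground hA rfl)
  · exact he.of_variant _ (.refl [.pos A]) (Node.closed_of_ground hA rfl)
      (Node.closed_of_ground hA rfl)

/-- A derivation step, performed on an instance. -/
theorem Tracks.child {R R' : ResolutionRule L} {P : Program L} {I : Finset ℕ} {γ γ₁ θ : Subst L}
    {N N' N₁ : Node L} {e : Edge} (h : Tracks I γ N N') (hc : N.child R P e = some (θ, N₁))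
    (hground : ∀ x ∈ nextInputs I θ, (γ₁ x).varFinset = ∅)
    (hout : ∀ x ∉ nextInputs I θ, γ₁ x = Term.var x) (hγ : ∀ x ∈ I, γ x = (θ x).subst γ₁) :
    ∃ θ' N₁', N'.child R' P e = some (θ', N₁') ∧ Tracks (nextInputs I θ) γ₁ N₁ N₁' := by
  -- Negative steps bind nothing, and compatibility then forces the grounding to stay the same.
  have hvar : θ = Term.var → γ₁ = γ := by
    rintro rfl
    funext x
    by_cases hx : x ∈ I
    · exact (hγ x hx).symm
    · rw [h.inst.outside x hx]
      exact hout x (by rwa [nextInputs_var])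
  cases e with
  | clause k =>
    obtain ⟨hp, hr⟩ := Node.child_clause.1 hc
    obtain ⟨θ', N₁', hr', hi⟩ := h.inst.resolvent (R' := R') h.inputs h.closed h.closed' hr
      hground hout hγ
    exact ⟨θ', N₁', Node.child_clause.2 ⟨h.prune.1 hp, hr'⟩, h.resolvent hr hr' hi⟩
  | naf =>
    obtain ⟨A, anc, rest, hg, hA, he, hθ, rfl⟩ := Node.child_naf.1 hc
    obtain ⟨anc', rest', hg', h1, -, h3⟩ := h.negation (R := R) (R' := R') (P := P) hg hA
    rw [hvar hθ, hθ, nextInputs_var]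
    exact ⟨_, _, Node.child_naf.2 ⟨A, anc', rest', hg', hA, (h3 _).1 he, rfl, rfl⟩, h1⟩
  | neg =>
    obtain ⟨A, anc, rest, hg, hA, hθ, rfl⟩ := Node.child_neg.1 hc
    obtain ⟨anc', rest', hg', -, h2, -⟩ := h.negation (R := R) (R' := R') (P := P) hg hA
    rw [hvar hθ, hθ, nextInputs_var]
    exact ⟨_, _, Node.child_neg.2 ⟨A, anc', rest', hg', hA, rfl, rfl⟩, h2⟩

/-- A derivation step for an instance, lifted. -/
theorem Tracks.lift_child {R R' : ResolutionRule L} {P : Program L} {I : Finset ℕ}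
    {γ θ' : Subst L} {N N' N₁' : Node L} {e : Edge} (h : Tracks I γ N N')
    (hnf : ∀ A anc rest, N.goal = ⟨.neg A, anc⟩ :: rest → A.IsGround)
    (hc : N'.child R' P e = some (θ', N₁')) :
    ∃ θ N₁ γ₁, N.child R P e = some (θ, N₁) ∧ Tracks (nextInputs I θ) γ₁ N₁ N₁' ∧
      (∀ x ∈ I, γ₁ x = γ x) ∧ ∀ x ∈ I, γ x = (θ x).subst γ₁ := by
  have hsel : ∀ A' anc' rest', N'.goal = ⟨.neg A', anc'⟩ :: rest' →
      ∃ A anc rest, N.goal = ⟨.neg A, anc⟩ :: rest ∧ A.IsGround := by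
    intro A' anc' rest' hg'
    have hi := h.inst
    rw [Node.lits_of_goal hg'] at hi
    obtain ⟨A, ms, hA⟩ := hi.exists_neg
    obtain ⟨⟨l, anc⟩, rest, hg, hl, -⟩ := List.map_eq_cons_iff.1 hA
    simp only at hl
    subst hl
    exact ⟨A, anc, rest, hg, hnf A anc rest hg⟩
  cases e with
  | clause k =>
    obtain ⟨hp, hr'⟩ := Node.child_clause.1 hc
    obtain ⟨θ, N₁, γ₁, hr, hi, h1, h2⟩ := h.inst.lift_resolvent (R := R) h.inputs h.closed
      h.closed' hr'
    exact ⟨θ, N₁, γ₁, Node.child_clause.2 ⟨h.prune.2 hp, hr⟩, h.resolvent hr hr' hi, h1, h2⟩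
  | naf =>
    obtain ⟨A', anc', rest', hg', hA', he, rfl, rfl⟩ := Node.child_naf.1 hc
    obtain ⟨A, anc, rest, hg, hA⟩ := hsel A' anc' rest' hg'
    obtain ⟨anc'', rest'', hg'', h1, -, h3⟩ := h.negation (R := R) (R' := R') (P := P) hg hA
    rw [hg'] at hg''
    simp only [List.cons.injEq, Subgoal.mk.injEq, Literal.neg.injEq] at hg''
    obtain ⟨⟨rfl, rfl⟩, rfl⟩ := hg''
    refine ⟨_, _, γ, Node.child_naf.2 ⟨A', anc, rest, hg, hA, (h3 _).2 he, rfl, rfl⟩, ?_,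
      fun _ _ => rfl, fun _ _ => rfl⟩
    rwa [nextInputs_var]
  | neg =>
    obtain ⟨A', anc', rest', hg', hA', rfl, rfl⟩ := Node.child_neg.1 hc
    obtain ⟨A, anc, rest, hg, hA⟩ := hsel A' anc' rest' hg'
    obtain ⟨anc'', rest'', hg'', -, h2, -⟩ := h.negation (R := R) (R' := R') (P := P) hg hA
    rw [hg'] at hg''
    simp only [List.cons.injEq, Subgoal.mk.injEq, Literal.neg.injEq] at hg''
    obtain ⟨⟨rfl, rfl⟩, rfl⟩ := hg''
    refine ⟨_, _, γ, Node.child_neg.2 ⟨A', anc, rest, hg, hA, rfl, rfl⟩, ?_,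
      fun _ _ => rfl, fun _ _ => rfl⟩
    rwa [nextInputs_var]

/-! ## Permanent ancestors -/

/-- The ancestors of the subgoals of a goal. -/
def Node.ancs (N : Node L) : List (Finset ℕ) := N.goal.map Subgoal.anc

/-- For the ancestor relation a goal behaves like a stack: a clause replaces the top by subgoals
that have the selected node as an additional ancestor, failure pops it, and a negation arc keeps
only the top. -/
theorem Node.child_ancs {R : ResolutionRule L} {P : Program L} {N N₁ : Node L} {e : Edge}
    {θ : Subst L} (h : N.child R P e = some (θ, N₁)) : ∃ a r, N.ancs = a :: r ∧
      ((∃ k m, e = .clause k ∧ N₁.ancs = List.replicate m (insert N.depth a) ++ r) ∨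
        (e = .naf ∧ N₁.ancs = r) ∨ (e = .neg ∧ N₁.ancs = [a])) := by
  cases e with
  | clause k =>
    obtain ⟨A, anc, rest, C, K, hg, -, -, rfl⟩ := Node.resolvent_eq_some.1 (Node.child_clause.1 h).2
    refine ⟨anc, rest.map Subgoal.anc, by simp [Node.ancs, hg], Or.inl ⟨k, K.body.length, rfl, ?_⟩⟩
    simp [Node.ancs, Function.comp_def, List.map_const']
  | naf =>
    obtain ⟨A, anc, rest, hg, -, -, -, rfl⟩ := Node.child_naf.1 h
    exact ⟨anc, rest.map Subgoal.anc, by simp [Node.ancs, hg], Or.inr (Or.inl ⟨rfl, rfl⟩)⟩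
  | neg =>
    obtain ⟨A, anc, rest, hg, -, -, rfl⟩ := Node.child_neg.1 h
    exact ⟨anc, rest.map Subgoal.anc, by simp [Node.ancs, hg], Or.inr (Or.inr ⟨rfl, rfl⟩)⟩

theorem Node.child_neg_next {R : ResolutionRule L} {P : Program L} {N N₁ N₂ : Node L} {e : Edge}
    {θ θ₁ : Subst L} (h : N.child R P .neg = some (θ, N₁)) (h₁ : N₁.child R P e = some (θ₁, N₂)) :
    ∃ k, e = .clause k := by
  obtain ⟨A, anc, rest, -, -, -, rfl⟩ := Node.child_neg.1 h
  cases e with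
  | clause k => exact ⟨k, rfl⟩
  | naf =>
    obtain ⟨A, anc, rest, hg, -⟩ := Node.child_naf.1 h₁
    simp at hg
  | neg =>
    obtain ⟨A, anc, rest, hg, -⟩ := Node.child_neg.1 h₁
    simp at hg

section InfinitePath

variable {R : ResolutionRule L} {P : Program L} {N : ℕ → Node L} {e : ℕ → Edge} {θ : ℕ → Subst L}

theorem depth_of_path (h0 : (N 0).path = [])
    (hstep : ∀ i, (N i).child R P (e i) = some (θ i, N (i + 1))) (i : ℕ) : (N i).depth = i := by
  induction i with
  | zero => simp [Node.depth, h0]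
  | succ i ih =>
    rw [Node.depth, Node.child_path (hstep i), List.length_append, ← Node.depth, ih]
    rfl

/-- A subgoal to which a clause is applied stays an ancestor, as long as the subgoals behind it are
not reached, or if there are none. -/
theorem ancestor_of_front (h0 : (N 0).path = [])
    (hstep : ∀ i, (N i).child R P (e i) = some (θ i, N (i + 1))) {i k : ℕ} (hi : e i = .clause k)
    {a : Finset ℕ} {r : List (Finset ℕ)} (ha : (N i).ancs = a :: r)
    (hr : r = [] ∨ ∀ j > i, e j ≠ .neg ∧ r.length < (N j).ancs.length) :
    ∀ j > i, ∃ b s, (N j).ancs = b :: s ∧ i ∈ b := by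
  -- Invariant: above the untouched bottom `r` of the stack, every subgoal has node `i` among its
  -- ancestors.
  have key : ∀ j > i, ∃ f, (N j).ancs = f ++ r ∧ ∀ b ∈ f, i ∈ b := by
    intro j hj
    induction j, hj using Nat.le_induction with
    | base =>
      obtain ⟨a', r', ha', ⟨k', m, -, h⟩ | ⟨h, -⟩ | ⟨h, -⟩⟩ := Node.child_ancs (hstep i)
      · rw [ha] at ha'
        obtain ⟨rfl, rfl⟩ := List.cons.inj ha'
        refine ⟨_, h, fun b hb => ?_⟩
        rw [List.eq_of_mem_replicate hb, depth_of_path h0 hstep]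
        exact Finset.mem_insert_self _ _
      · simp [hi] at h
      · simp [hi] at h
    | succ j hj ih =>
      obtain ⟨f, hf, hfi⟩ := ih
      obtain ⟨b, s, hb, hcases⟩ := Node.child_ancs (hstep j)
      rw [hf] at hb
      cases f with
      | nil =>
        exfalso
        simp only [List.nil_append] at hb hf
        obtain hr | hr := hr
        · simp [hr] at hb
        · have := (hr j hj).2
          simp [hf] at this
      | cons c f =>
        obtain ⟨rfl, rfl⟩ := List.cons.inj hb
        have hc := hfi c (by simp)
        obtain ⟨k', m, -, h⟩ | ⟨-, h⟩ | ⟨hn, h⟩ := hcases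
        · refine ⟨List.replicate m (insert (N j).depth c) ++ f, by simp [h], fun b hb => ?_⟩
          obtain hb | hb := List.mem_append.1 hb
          · rw [List.eq_of_mem_replicate hb]
            exact Finset.mem_insert_of_mem hc
          · exact hfi b (by simp [hb])
        · exact ⟨f, h, fun b hb => hfi b (by simp [hb])⟩
        · obtain hr | hr := hr
          · exact ⟨[c], by simp [h, hr], by simpa using hc⟩
          · exact absurd hn (hr j hj).1
  intro j hj
  obtain ⟨f, hf, hfi⟩ := key j hj
  obtain ⟨b, s, hb, -⟩ := Node.child_ancs (hstep j)
  cases f with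
  | nil =>
    exfalso
    simp only [List.nil_append] at hf
    obtain hr | hr := hr
    · simp [hf, hr] at hb
    · have := (hr j hj).2
      simp [hf] at this
  | cons c f => exact ⟨c, f ++ r, hf, hfi c (by simp)⟩

/-- If a negation arc occurs after `n`, the root below it is a single subgoal, from which everything
later descends. Otherwise take a goal of least length after `n`: the subgoals behind its selected
one are never reached, so everything selected later descends from that one. -/
theorem exists_permanent (h0 : (N 0).path = [])
    (hstep : ∀ i, (N i).child R P (e i) = some (θ i, N (i + 1))) (n : ℕ) :
    ∃ i ≥ n, (∃ k, e i = .clause k) ∧ ∀ j > i, ∃ b s, (N j).ancs = b :: s ∧ i ∈ b := by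
  by_cases hneg : ∃ j ≥ n, e j = .neg
  · obtain ⟨j, hj, hej⟩ := hneg
    have hs := hstep j
    rw [hej] at hs
    obtain ⟨k, hk⟩ := Node.child_neg_next hs (hstep (j + 1))
    obtain ⟨a, r, -, ⟨k', m, h, -⟩ | ⟨h, -⟩ | ⟨-, h⟩⟩ := Node.child_ancs hs
    · cases h
    · cases h
    · exact ⟨j + 1, by omega, ⟨k, hk⟩, ancestor_of_front h0 hstep hk h (Or.inl rfl)⟩
  · push Not at hneg
    obtain ⟨i, hi, hmin⟩ := exists_minimalFor_of_wellFoundedLT (· ≥ n) (fun i => (N i).ancs.length)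
      ⟨n, le_rfl⟩
    have hmin' : ∀ j ≥ n, (N i).ancs.length ≤ (N j).ancs.length := fun j hj => by
      by_contra hlt
      exact hlt (hmin hj (by simp only at *; omega))
    obtain ⟨a, r, ha, ⟨k, m, h, -⟩ | ⟨-, h⟩ | ⟨h, -⟩⟩ := Node.child_ancs (hstep i)
    · refine ⟨i, hi, ⟨k, h⟩, ancestor_of_front h0 hstep h ha (Or.inr fun j hj => ?_)⟩
      have hjn : j ≥ n := le_trans hi (le_of_lt hj)
      refine ⟨hneg j hjn, ?_⟩
      have := hmin' j hjn
      rw [ha, List.length_cons] at this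
      omega
    -- Dropping a negative subgoal would make the next goal shorter than the minimum.
    · have := hmin' (i + 1) (le_trans hi (Nat.le_succ i))
      rw [ha, h, List.length_cons] at this
      omega
    · exact absurd h (hneg i hi)

end InfinitePath

/-! ## Symbol strings -/

theorem funcsIn_iff (S : Set (Σ n, L.Functions n)) (t : L.Term ℕ) :
    FuncsIn S t ↔ ∀ n (f : L.Functions n), Symbol.func f ∈ termSymbolString t → ⟨n, f⟩ ∈ S := by
  induction t with
  | var => simp [FuncsIn, termSymbolString]
  | func f ts ih =>
    simp only [FuncsIn, ih, termSymbolString, List.mem_cons, Symbol.func.injEq, List.mem_flatten,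
      List.mem_ofFn]
    constructor
    · rintro ⟨h1, h2⟩ n g (⟨rfl, h⟩ | ⟨_, ⟨i, rfl⟩, h⟩)
      · obtain rfl := eq_of_heq h
        exact h1
      · exact h2 i n g h
    · exact fun h => ⟨h _ f (Or.inl ⟨rfl, HEq.rfl⟩), fun i n g hg => h n g (Or.inr ⟨_, ⟨i, rfl⟩, hg⟩)⟩

theorem pred_notMem_termSymbolString (t : L.Term ℕ) {n : ℕ} (p : L.Relations n) :
    Symbol.pred p ∉ termSymbolString t := by
  induction t with
  | var => simp [termSymbolString]
  | func f ts ih => simpa [termSymbolString, List.mem_ofFn] using ih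

theorem Atom.mem_symbolString {A : Atom L} {s : Symbol L} :
    s ∈ A.symbolString ↔ s = Symbol.pred A.pred ∨ ∃ i, s ∈ termSymbolString (A.args i) := by
  simp [Atom.symbolString, List.mem_ofFn]

/-- Predicate symbols, with their arities, occur only at the head of a symbol string. The
subsequence relation therefore already forces equal predicates. -/
theorem Atom.loopsInto_of_sublist {A B : Atom L} (h : A.symbolString.Sublist B.symbolString) :
    A.LoopsInto B := by
  refine ⟨?_, h⟩
  have : Symbol.pred A.pred ∈ B.symbolString :=
    h.subset (Atom.mem_symbolString.2 (Or.inl rfl))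
  obtain h | ⟨i, hi⟩ := Atom.mem_symbolString.1 this
  · simp only [Symbol.pred.injEq] at h
    exact Sigma.ext h.1 h.2
  · exact absurd hi (pred_notMem_termSymbolString _ _)

/-- The predicate symbol of the atom is in `S` and its function symbols are in `F`. -/
structure Atom.SymbolsIn (S : Set (Σ n, L.Relations n)) (F : Set (Σ n, L.Functions n))
    (A : Atom L) : Prop where
  pred : ⟨A.arity, A.pred⟩ ∈ S
  funcs : A.FuncsIn F

theorem exists_finite_symbolsIn (ls : List (Literal L)) :
    ∃ (S : Set (Σ n, L.Relations n)) (F : Set (Σ n, L.Functions n)), S.Finite ∧ F.Finite ∧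
      ∀ l ∈ ls, l.atom.SymbolsIn S F := by
  refine ⟨(fun l : Literal L => ⟨l.atom.arity, l.atom.pred⟩) '' {l | l ∈ ls},
    (fun f : Σ n, L.Functions n => Symbol.func f.2) ⁻¹'
      {s | s ∈ ls.flatMap fun l => l.atom.symbolString},
    (List.finite_toSet ls).image _, (List.finite_toSet _).preimage ?_, fun l hl => ⟨⟨l, hl, rfl⟩, ?_⟩⟩
  · rintro ⟨n, f⟩ - ⟨m, g⟩ - h
    simp only [Symbol.func.injEq] at h
    exact Sigma.ext h.1 h.2
  · intro i
    rw [funcsIn_iff]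
    intro n f hf
    exact List.mem_flatMap.2 ⟨l, hl, Atom.mem_symbolString.2 (Or.inr ⟨i, hf⟩)⟩

theorem Atom.SymbolsIn.subst {S : Set (Σ n, L.Relations n)} {F : Set (Σ n, L.Functions n)}
    {A : Atom L} (h : A.SymbolsIn S F) {σ : Subst L} (hσ : ∀ x, LogicProg.FuncsIn F (σ x)) :
    (A.subst σ).SymbolsIn S F :=
  ⟨h.pred, (Atom.funcsIn_subst F A σ).2 ⟨h.funcs, fun x _ => hσ x⟩⟩

/-- The finitely many symbols that atoms over `S` and `F` are built from. -/
def symbolSet (S : Set (Σ n, L.Relations n)) (F : Set (Σ n, L.Functions n)) : Set (Symbol L) :=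
  insert Symbol.X ((fun p => Symbol.pred p.2) '' S ∪ (fun f => Symbol.func f.2) '' F)

theorem Atom.SymbolsIn.mem_symbolSet {S : Set (Σ n, L.Relations n)} {F : Set (Σ n, L.Functions n)}
    {A : Atom L} (h : A.SymbolsIn S F) {s : Symbol L} (hs : s ∈ A.symbolString) :
    s ∈ symbolSet S F := by
  obtain rfl | ⟨i, hi⟩ := Atom.mem_symbolString.1 hs
  · exact Or.inr (Or.inl ⟨_, h.pred, rfl⟩)
  · cases s with
    | pred p => exact absurd hi (pred_notMem_termSymbolString _ _)
    | func f => exact Or.inr (Or.inr ⟨⟨_, f⟩, (funcsIn_iff _ _).1 (h.funcs i) _ f hi, rfl⟩)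
    | X => exact Or.inl rfl

/-- Renaming, mgus and the deletion of subgoals introduce no predicate or function symbols. This
keeps the alphabet of symbol strings finite along a derivation. -/
theorem Node.child_symbolsIn {R : ResolutionRule L} {P : Program L} {N N₁ : Node L} {e : Edge}
    {θ : Subst L} {S : Set (Σ n, L.Relations n)} {F : Set (Σ n, L.Functions n)}
    (hP : ∀ C ∈ P, ∀ l ∈ C.lits, l.atom.SymbolsIn S F)
    (hN : ∀ l ∈ N.lits, l.atom.SymbolsIn S F)
    (h : N.child R P e = some (θ, N₁)) : ∀ l ∈ N₁.lits, l.atom.SymbolsIn S F := by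
  cases e with
  | clause k =>
    obtain ⟨A, anc, rest, C, K, hg, hC, hres, rfl⟩ :=
      Node.resolvent_eq_some.1 (Node.child_clause.1 h).2
    obtain ⟨⟨π, rfl⟩, -, hm⟩ := R.sound _ _ _ _ _ hres
    rw [Node.lits_of_goal hg] at hN
    have hK : ∀ l ∈ (C.subst fun x => Term.var (π x)).lits, l.atom.SymbolsIn S F := by
      intro l hl
      rw [Clause.lits_subst] at hl
      obtain ⟨l, hl', rfl⟩ := List.mem_map.1 hl
      rw [Literal.atom_subst]
      exact (hP C (List.mem_of_getElem? hC) l hl').subst fun _ => trivial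
    have hθ := hm.funcsIn (hN _ (List.mem_cons_self ..)).funcs (hK _ (List.mem_cons_self ..)).funcs
    simp only [Node.lits]
    rw [lits_resolvent]
    intro l hl
    obtain ⟨l, hl', rfl⟩ := List.mem_map.1 hl
    rw [Literal.atom_subst]
    refine Atom.SymbolsIn.subst ?_ hθ
    obtain hl | hl := List.mem_append.1 hl'
    · exact hK l (List.mem_cons_of_mem _ hl)
    · exact hN l (List.mem_cons_of_mem _ hl)
  | naf =>
    obtain ⟨A, anc, rest, hg, -, -, -, rfl⟩ := Node.child_naf.1 h
    rw [Node.lits_of_goal hg] at hN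
    exact fun l hl => hN l (List.mem_cons_of_mem _ hl)
  | neg =>
    obtain ⟨A, anc, rest, hg, -, -, rfl⟩ := Node.child_neg.1 h
    rw [Node.lits_of_goal hg] at hN
    intro l hl
    rw [List.mem_singleton.1 hl]
    exact hN (.neg A) (List.mem_cons_self ..)

/-! ## Loop goals in infinite derivations -/

theorem exists_loop_goals {R : ResolutionRule L} {P : Program L} {A : Atom L} {I : Finset ℕ}
    (D : (genSLDNFTree R P A I).InfiniteDerivation) :
    ∃ g : ℕ → ℕ, StrictMono g ∧ ∀ j, D.IsLoopGoal (g j) (g (j + 1)) := by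
  have hstep : ∀ i, (D.node i).child R P (D.edge i) = some (D.subst i, D.node (i + 1)) := D.step
  have h0 : (D.node 0).path = [] := by rw [D.start]; rfl
  obtain ⟨S, F, hS, hF, hSF⟩ := exists_finite_symbolsIn (.pos A :: P.flatMap Clause.lits)
  have hsymb : ∀ i, ∀ l ∈ (D.node i).lits, l.atom.SymbolsIn S F := by
    intro i
    induction i with
    | zero =>
      rw [D.start]
      intro l hl
      rw [List.mem_singleton.1 hl]
      exact hSF _ (List.mem_cons_self ..)
    | succ i ih =>
      exact Node.child_symbolsIn (fun C hC l hl => hSF l (List.mem_cons_of_mem _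
        (List.mem_flatMap.2 ⟨C, hC, hl⟩))) ih (hstep i)
  obtain ⟨φ, hφ, hperm⟩ := Nat.exists_strictMono_subsequence fun n =>
    let ⟨i, hi, h⟩ := exists_permanent h0 hstep (n + 1)
    ⟨i, (hi : n < i), h⟩
  have hsel : ∀ n, ∃ B anc rest, (D.node (φ n)).goal = ⟨.pos B, anc⟩ :: rest := by
    intro n
    obtain ⟨⟨k, hk⟩, -⟩ := hperm n
    have h := hstep (φ n)
    rw [hk] at h
    obtain ⟨B, anc, rest, C, K, hg, -⟩ := Node.resolvent_eq_some.1 (Node.child_clause.1 h).2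
    exact ⟨B, anc, rest, hg⟩
  choose B anc rest hg using hsel
  have hfin : (symbolSet S F).Finite := ((hS.image _).union (hF.image _)).insert _
  have : IsPreorder (List (Symbol L)) (List.SublistForall₂ Eq) := { }
  -- Higman's lemma over the finite alphabet, with equality as the order on letters. An infinite
  -- increasing subsequence makes every consecutive pair a loop pair.
  obtain ⟨ψ, hψ⟩ := (Set.PartiallyWellOrderedOn.partiallyWellOrderedOn_sublistForall₂ Eq
    (hfin.partiallyWellOrderedOn (r := Eq))).exists_monotone_subseq
    (f := fun n => (B n).symbolString) fun n s hs => by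
      refine (hsymb (φ n) (.pos (B n)) ?_).mem_symbolSet hs
      rw [Node.lits_of_goal (hg n)]
      exact List.mem_cons_self ..
  have hmono : StrictMono fun n => φ (ψ n) := hφ.comp ψ.strictMono
  refine ⟨fun n => φ (ψ n), hmono, fun j => ⟨_, _, _, _, _, _, hg _, hg _, ?_, ?_⟩⟩
  · obtain ⟨b, s, hb, hi⟩ := (hperm (ψ j)).2 _ (hmono (Nat.lt_succ_self j))
    rw [Node.ancs, hg] at hb
    rwa [← (List.cons.inj hb).1] at hi
  · refine Atom.loopsInto_of_sublist ?_
    obtain ⟨l, hl, hsub⟩ := List.sublistForall₂_iff.1 (hψ j (j + 1) (Nat.le_succ j))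
    rw [List.forall₂_eq_eq_eq] at hl
    exact hl ▸ hsub

/-! ## Bindings of input variables -/

/-- Dependent choice with an invariant `p`. It yields König's lemma and both constructions of
derivations. -/
theorem exists_seq_of_step {α : Type*} {p : ℕ → α → Prop} {q : ℕ → α → α → Prop} {a : α}
    (h0 : p 0 a) (hs : ∀ n a, p n a → ∃ b, p (n + 1) b ∧ q n a b) :
    ∃ f : ℕ → α, f 0 = a ∧ ∀ n, p n (f n) ∧ q n (f n) (f (n + 1)) := by
  choose! g hg using hs
  let f : ℕ → α := fun n => Nat.rec a (fun n b => g n b) n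
  have hp : ∀ n, p n (f n) := by
    intro n
    induction n with
    | zero => exact h0
    | succ n ih => exact (hg n (f n) ih).1
  exact ⟨f, rfl, fun n => ⟨hp n, (hg n (f n) (hp n)).2⟩⟩

/-- König's lemma, for the elements reachable from `x`. -/
theorem exists_chain_of_infinite {α : Type*} {r : α → α → Prop} (hfin : ∀ x, {y | r x y}.Finite)
    {x : α} (hx : {y | Relation.ReflTransGen r x y}.Infinite) :
    ∃ Y : ℕ → α, Y 0 = x ∧ ∀ n, r (Y n) (Y (n + 1)) := by
  obtain ⟨Y, h0, hY⟩ := exists_seq_of_step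
    (p := fun _ x => {y | Relation.ReflTransGen r x y}.Infinite) (q := fun _ x y => r x y) hx
    fun _ x hx => by
      by_contra! hne
      refine hx (((Set.finite_singleton x).union ((hfin x).biUnion (t := fun y =>
        {z | Relation.ReflTransGen r y z}) fun y hy => ?_)).subset fun z hz => ?_)
      · by_contra hinf
        exact hne y hinf hy
      · obtain rfl | ⟨y, hy, hyz⟩ := Relation.ReflTransGen.cases_head hz
        · exact Or.inl rfl
        · exact Or.inr (Set.mem_biUnion hy hyz)
  exact ⟨Y, h0, fun n => (hY n).2⟩

/-! ### Recorded, bound and dead variables along a step -/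

theorem Node.Closed.child {R : ResolutionRule L} {P : Program L} {N N₁ : Node L} {e : Edge}
    {θ : Subst L} (hN : N.Closed) (h : N.child R P e = some (θ, N₁)) : N₁.Closed := by
  cases e with
  | clause k => exact hN.resolvent (Node.child_clause.1 h).2
  | naf =>
    obtain ⟨A, anc, rest, hg, -, -, -, rfl⟩ := Node.child_naf.1 h
    exact hN.tail hg rfl rfl
  | neg =>
    obtain ⟨A, anc, rest, -, hA, -, rfl⟩ := Node.child_neg.1 h
    exact Node.closed_of_ground hA rfl

theorem Node.child_used {R : ResolutionRule L} {P : Program L} {N N₁ : Node L} {e : Edge}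
    {θ : Subst L} (h : N.child R P e = some (θ, N₁)) : N.used ⊆ N₁.used := by
  cases e with
  | clause k =>
    obtain ⟨A, anc, rest, C, K, -, -, -, rfl⟩ := Node.resolvent_eq_some.1 (Node.child_clause.1 h).2
    exact Finset.subset_union_left
  | naf =>
    obtain ⟨A, anc, rest, hg, -, -, -, rfl⟩ := Node.child_naf.1 h
    exact subset_rfl
  | neg =>
    obtain ⟨A, anc, rest, -, -, -, rfl⟩ := Node.child_neg.1 h
    exact subset_rfl

theorem Node.child_inputs_subset_used {R : ResolutionRule L} {P : Program L} {N N₁ : Node L}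
    {e : Edge} {θ : Subst L} (hN : N.Closed) (hI : N.inputs ⊆ N.used)
    (h : N.child R P e = some (θ, N₁)) : N₁.inputs ⊆ N₁.used := by
  rw [Node.child_inputs h]
  cases e with
  | clause k => exact nextInputs_subset_used hN hI (Node.child_clause.1 h).2
  | naf =>
    obtain ⟨A, anc, rest, hg, -, -, rfl, rfl⟩ := Node.child_naf.1 h
    rwa [nextInputs_var]
  | neg =>
    obtain ⟨A, anc, rest, -, -, rfl, rfl⟩ := Node.child_neg.1 h
    rwa [nextInputs_var]

/-- A substitution made in a step that binds a variable is the mgu of a resolution. -/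
theorem Node.child_bound {R : ResolutionRule L} {P : Program L} {N N₁ : Node L} {e : Edge}
    {θ : Subst L} (h : N.child R P e = some (θ, N₁)) (hθ : θ ≠ Term.var) :
    ∃ k, N.resolvent R P k = some (θ, N₁) := by
  cases e with
  | clause k => exact ⟨k, (Node.child_clause.1 h).2⟩
  | naf =>
    obtain ⟨A, anc, rest, hg, -, -, rfl, -⟩ := Node.child_naf.1 h
    exact absurd rfl hθ
  | neg =>
    obtain ⟨A, anc, rest, -, -, rfl, -⟩ := Node.child_neg.1 h
    exact absurd rfl hθ

theorem Node.child_idempotent {R : ResolutionRule L} {P : Program L} {N N₁ : Node L} {e : Edge}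
    {θ : Subst L} (h : N.child R P e = some (θ, N₁)) (x : ℕ) : (θ x).subst θ = θ x := by
  by_cases hθ : θ = Term.var
  · rw [hθ]
    rfl
  · obtain ⟨k, hr⟩ := Node.child_bound h hθ
    obtain ⟨A, anc, rest, C, K, hg, hC, hres, -⟩ := Node.resolvent_eq_some.1 hr
    exact (R.sound _ _ _ _ _ hres).2.2.idempotent x

/-- A variable that has been used, but does not occur in the goal. -/
def Node.Dead (N : Node L) (x : ℕ) : Prop := x ∈ N.used ∧ ¬ OccursIn x N.lits

/-- A dead variable is absent from the goal, and fresh clause variants avoid all used variables; the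
step cannot involve it. -/
theorem Node.notMem_vars_of_dead {R : ResolutionRule L} {N : Node L} {A : Atom L} {C K : Clause L}
    {θ : Subst L} {anc : Finset ℕ} {rest : List (Subgoal L)} {x : ℕ}
    (hg : N.goal = ⟨.pos A, anc⟩ :: rest) (hres : R.resolve N A C = some (K, θ))
    (hx : N.Dead x) : x ∉ A.vars ∪ K.head.vars ∧ ¬ OccursIn x (K.body ++ rest.map Subgoal.lit) := by
  obtain ⟨hxu, hxo⟩ := hx
  have hK : ¬ OccursIn x K.lits := fun h =>
    Finset.disjoint_left.1 (R.sound _ _ _ _ _ hres).2.1 (Clause.mem_vars.2 h) hxu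
  rw [Node.lits_of_goal hg, occursIn_cons] at hxo
  rw [Clause.lits, occursIn_cons] at hK
  rw [Finset.mem_union, occursIn_append]
  simp only [Literal.atom] at hxo hK
  tauto

theorem Node.Dead.subst_eq {R : ResolutionRule L} {P : Program L} {N N₁ : Node L} {e : Edge}
    {θ : Subst L} {x : ℕ} (hx : N.Dead x) (h : N.child R P e = some (θ, N₁)) :
    θ x = Term.var x := by
  by_cases hθ : θ = Term.var
  · rw [hθ]
  · obtain ⟨k, hr⟩ := Node.child_bound h hθ
    obtain ⟨A, anc, rest, C, K, hg, hC, hres, -⟩ := Node.resolvent_eq_some.1 hr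
    exact (R.sound _ _ _ _ _ hres).2.2.support x (Node.notMem_vars_of_dead hg hres hx).1

theorem Node.Dead.child {R : ResolutionRule L} {P : Program L} {N N₁ : Node L} {e : Edge}
    {θ : Subst L} {x : ℕ} (hx : N.Dead x) (h : N.child R P e = some (θ, N₁)) : N₁.Dead x := by
  refine ⟨Node.child_used h hx.1, ?_⟩
  cases e with
  | clause k =>
    obtain ⟨A, anc, rest, C, K, hg, hC, hres, rfl⟩ :=
      Node.resolvent_eq_some.1 (Node.child_clause.1 h).2
    have hm := (R.sound _ _ _ _ _ hres).2.2
    obtain ⟨h1, h2⟩ := Node.notMem_vars_of_dead hg hres hx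
    simp only [Node.lits]
    rw [lits_resolvent, occursIn_map_subst]
    rintro ⟨z, hz, hxz⟩
    by_cases hzAB : z ∈ A.vars ∪ K.head.vars
    · exact h1 (hm.range z hzAB hxz)
    · rw [hm.support z hzAB] at hxz
      simp only [Term.varFinset, Finset.mem_singleton] at hxz
      exact h2 (hxz ▸ hz)
  | naf =>
    obtain ⟨A, anc, rest, hg, -, -, -, rfl⟩ := Node.child_naf.1 h
    intro ho
    refine hx.2 ?_
    rw [Node.lits_of_goal hg]
    exact occursIn_cons.2 (Or.inr ho)
  | neg =>
    obtain ⟨A, anc, rest, hg, -, -, rfl⟩ := Node.child_neg.1 h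
    intro ho
    refine hx.2 ?_
    rw [Node.lits_of_goal hg]
    simp only [Node.lits, List.map_cons, List.map_nil, occursIn_cons] at ho
    obtain ho | ⟨_, hl, -⟩ := ho
    · exact occursIn_cons.2 (Or.inl ho)
    · simp at hl

/-- An idempotent mgu leaves no occurrence of a variable that it moves. -/
theorem Node.dead_of_bound {R : ResolutionRule L} {P : Program L} {N N₁ : Node L} {e : Edge}
    {θ : Subst L} {x : ℕ} (h : N.child R P e = some (θ, N₁)) (hx : x ∈ N.used)
    (hθx : θ x ≠ Term.var x) : N₁.Dead x := by
  have hid := Node.child_idempotent h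
  obtain ⟨k, hr⟩ := Node.child_bound h fun hθ => hθx (by rw [hθ])
  refine ⟨Node.child_used h hx, ?_⟩
  obtain ⟨A, anc, rest, C, K, hg, hC, hres, rfl⟩ := Node.resolvent_eq_some.1 hr
  simp only [Node.lits]
  rw [lits_resolvent, occursIn_map_subst]
  rintro ⟨z, -, hz⟩
  exact hθx (eq_var_of_idempotent hid hz)

/-- Variables introduced by a binding are not dead. -/
theorem Node.Dead.notMem_varFinset {R : ResolutionRule L} {P : Program L} {N N₁ : Node L} {e : Edge}
    {θ : Subst L} {x y : ℕ} (hy : N.Dead y) (h : N.child R P e = some (θ, N₁))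
    (hθx : θ x ≠ Term.var x) : y ∉ (θ x).varFinset := by
  obtain ⟨k, hr⟩ := Node.child_bound h fun hθ => hθx (by rw [hθ])
  obtain ⟨A, anc, rest, C, K, hg, hC, hres, rfl⟩ := Node.resolvent_eq_some.1 hr
  have hm := (R.sound _ _ _ _ _ hres).2.2
  intro hyx
  refine (Node.notMem_vars_of_dead hg hres hy).1 (hm.range x ?_ hyx)
  by_contra hx
  exact hθx (hm.support x hx)

/-- A bound input variable lies in the selected atom, since fresh clause heads avoid used variables;
the preference for input variables in moded mgus then applies. Hence new input variables arise only
from compound terms. -/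
theorem Node.input_of_child_eq_var {R : ResolutionRule L} {P : Program L} {N N₁ : Node L} {e : Edge}
    {θ : Subst L} {x y : ℕ} (h : N.child R P e = some (θ, N₁)) (hI : N.inputs ⊆ N.used)
    (hx : x ∈ N.inputs) (hxy : θ x = Term.var y) : y ∈ N.inputs := by
  by_cases hyx : y = x
  · exact hyx ▸ hx
  have hθx : θ x ≠ Term.var x := by
    rw [hxy]
    exact fun h => hyx (by simpa using h)
  obtain ⟨k, hr⟩ := Node.child_bound h fun hθ => hθx (by rw [hθ])
  obtain ⟨A, anc, rest, C, K, hg, hC, hres, rfl⟩ := Node.resolvent_eq_some.1 hr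
  obtain ⟨-, hd, hm⟩ := R.sound _ _ _ _ _ hres
  have hxA : x ∈ A.vars := by
    have hxAB : x ∈ A.vars ∪ K.head.vars := by
      by_contra hx
      exact hθx (hm.support x hx)
    refine (Finset.mem_union.1 hxAB).resolve_right fun hxB => ?_
    exact Finset.disjoint_left.1 hd (Clause.mem_vars.2 (occursIn_cons.2 (Or.inl hxB))) (hI hx)
  exact hm.input_var x hxA hx y hxy

section Chains

variable {R : ResolutionRule L} {P : Program L} {A : Atom L} {I : Finset ℕ}

theorem GenTree.InfiniteDerivation.closed (D : (genSLDNFTree R P A I).InfiniteDerivation) (i : ℕ) :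
    (D.node i).Closed := by
  induction i with
  | zero =>
    rw [D.start]
    rintro x ⟨l, hl, hx⟩
    rw [List.mem_singleton.1 hl] at hx
    exact hx
  | succ i ih => exact ih.child (D.step i)

theorem GenTree.InfiniteDerivation.inputs_subset_used
    (D : (genSLDNFTree R P A I).InfiniteDerivation) (hI : I ⊆ A.vars) (i : ℕ) :
    (D.node i).inputs ⊆ (D.node i).used := by
  induction i with
  | zero =>
    rw [D.start]
    exact hI
  | succ i ih => exact Node.child_inputs_subset_used (D.closed i) ih (D.step i)

theorem GenTree.InfiniteDerivation.inputs_succ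
    (D : (genSLDNFTree R P A I).InfiniteDerivation) (i : ℕ) :
    (D.node (i + 1)).inputs = nextInputs (D.node i).inputs (D.subst i) :=
  Node.child_inputs (D.step i)

theorem GenTree.InfiniteDerivation.dead_of_lt
    (D : (genSLDNFTree R P A I).InfiniteDerivation) (hI : I ⊆ A.vars) {i j x : ℕ} (hij : i < j)
    (hx : x ∈ (D.node i).inputs) (hθ : D.subst i x ≠ Term.var x) : (D.node j).Dead x := by
  induction j, hij using Nat.le_induction with
  | base => exact Node.dead_of_bound (D.step i) (D.inputs_subset_used hI i hx) hθ
  | succ j _ ih => exact ih.child (D.step j)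

/-- An input variable is bound at most once. -/
theorem GenTree.InfiniteDerivation.bound_unique
    (D : (genSLDNFTree R P A I).InfiniteDerivation) (hI : I ⊆ A.vars) {i j x : ℕ}
    (hi : x ∈ (D.node i).inputs) (hθi : D.subst i x ≠ Term.var x)
    (hj : x ∈ (D.node j).inputs) (hθj : D.subst j x ≠ Term.var x) : i = j := by
  rcases lt_trichotomy i j with h | h | h
  · exact absurd ((D.dead_of_lt hI h hi hθi).subst_eq (D.step j)) hθj
  · exact h
  · exact absurd ((D.dead_of_lt hI h hj hθj).subst_eq (D.step i)) hθi

/-- `y` occurs in the compound term that is substituted for the input variable `x` at node `i`. -/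
def GenTree.InfiniteDerivation.Expands {T : GenTree L} (D : T.InfiniteDerivation) (i x y : ℕ) :
    Prop :=
  x ∈ (D.node i).inputs ∧ ∃ (m : ℕ) (f : L.Functions m) (ts : Fin m → L.Term ℕ),
    D.subst i x = Term.func f ts ∧ y ∈ (Term.func f ts).varFinset

theorem GenTree.InfiniteDerivation.Expands.ne_var {T : GenTree L} {D : T.InfiniteDerivation}
    {i x y : ℕ} (h : D.Expands i x y) : D.subst i x ≠ Term.var x := by
  obtain ⟨-, m, f, ts, h, -⟩ := h
  rw [h]
  simp

/-- A variable introduced at step `i` is fixed by that step, by idempotence. Had it been bound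
earlier, it would be dead and could not be introduced. -/
theorem GenTree.InfiniteDerivation.Expands.lt {D : (genSLDNFTree R P A I).InfiniteDerivation}
    (hI : I ⊆ A.vars) {i j x y z : ℕ} (h : D.Expands i x y) (h' : D.Expands j y z) : i < j := by
  have hθ := h.ne_var
  obtain ⟨hx, m, f, ts, hxt, hy⟩ := h
  rw [← hxt] at hy
  by_contra hij
  obtain rfl | hij := (not_lt.1 hij).eq_or_lt
  · exact h'.ne_var (eq_var_of_idempotent (Node.child_idempotent (D.step j)) hy)
  · exact (D.dead_of_lt hI hij h'.1 h'.ne_var).notMem_varFinset (D.step i) hθ hy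

/-- Every input variable descends from one of the finitely many initial ones through bindings to
compound terms. Branching is finite because a variable is bound at most once, so König's lemma
supplies a path, whose steps are automatically in increasing order. -/
theorem GenTree.InfiniteDerivation.exists_hasInfiniteChain
    (D : (genSLDNFTree R P A I).InfiniteDerivation) (hI : I ⊆ A.vars)
    (hinf : {x | ∃ i, x ∈ (D.node i).inputs}.Infinite) : ∃ x, D.HasInfiniteChain x := by
  let r : ℕ → ℕ → Prop := fun x y => ∃ i, D.Expands i x y
  have hfin : ∀ x, {y | r x y}.Finite := by
    intro x
    by_cases hx : ∃ i y, D.Expands i x y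
    · obtain ⟨i, y, hi⟩ := hx
      refine (Finset.finite_toSet (D.subst i x).varFinset).subset ?_
      rintro z ⟨j, hj⟩
      obtain rfl := D.bound_unique hI hi.1 hi.ne_var hj.1 hj.ne_var
      obtain ⟨-, m, f, ts, h, hz⟩ := hj
      rw [h]
      exact hz
    · convert Set.finite_empty
      ext y
      simp only [Set.mem_ofPred_eq, Set.mem_empty_iff_false, iff_false]
      rintro ⟨i, hi⟩
      exact hx ⟨i, y, hi⟩
  have hreach : ∀ i, ∀ y ∈ (D.node i).inputs, ∃ x ∈ (D.node 0).inputs,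
      Relation.ReflTransGen r x y := by
    intro i
    induction i with
    | zero => exact fun y hy => ⟨y, hy, .refl⟩
    | succ i ih =>
      intro y hy
      rw [D.inputs_succ] at hy
      obtain hy | ⟨x, hx, hy⟩ := mem_nextInputs.1 hy
      · exact ih y hy
      · cases hxt : D.subst i x with
        | var z =>
          rw [hxt] at hy
          simp only [Term.varFinset, Finset.mem_singleton] at hy
          rw [hy]
          exact ih z (Node.input_of_child_eq_var (D.step i) (D.inputs_subset_used hI i) hx hxt)
        | func f ts =>
          obtain ⟨w, hw, hwx⟩ := ih x hx
          rw [hxt] at hy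
          exact ⟨w, hw, hwx.tail ⟨i, hx, _, f, ts, hxt, hy⟩⟩
  obtain ⟨x, -, hxinf⟩ : ∃ x ∈ (D.node 0).inputs, {y | Relation.ReflTransGen r x y}.Infinite := by
    by_contra! hne
    refine hinf (((D.node 0).inputs.finite_toSet.biUnion (t := fun x =>
      {y | Relation.ReflTransGen r x y}) fun x hx => ?_).subset ?_)
    · exact hne x hx
    · rintro y ⟨i, hi⟩
      obtain ⟨x, hx, hxy⟩ := hreach i y hi
      exact Set.mem_biUnion hx hxy
  obtain ⟨Y, h0, hY⟩ := exists_chain_of_infinite hfin hxinf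
  choose s hs using hY
  refine ⟨x, Y, s, strictMono_nat_of_lt_succ fun n => (hs n).lt hI (hs (n + 1)), h0,
    h0 ▸ (hs 0).1, fun n => (hs n).2⟩

/-- If there is no infinite chain, then from some node on no input variable is bound. -/
theorem GenTree.InfiniteDerivation.exists_forall_input_eq_var
    (D : (genSLDNFTree R P A I).InfiniteDerivation) (hI : I ⊆ A.vars)
    (h : ∀ x, ¬ D.HasInfiniteChain x) :
    ∃ n, ∀ i ≥ n, ∀ x ∈ (D.node i).inputs, D.subst i x = Term.var x := by
  have hfin : {x | ∃ i, x ∈ (D.node i).inputs}.Finite := by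
    by_contra hinf
    obtain ⟨x, hx⟩ := D.exists_hasInfiniteChain hI hinf
    exact h x hx
  -- Each of the finitely many input variables is eventually never bound again, and finitely many
  -- such bounds have a common one.
  have key : ∀ᶠ i in Filter.atTop, ∀ x ∈ {x | ∃ i, x ∈ (D.node i).inputs},
      x ∈ (D.node i).inputs → D.subst i x = Term.var x := by
    rw [Filter.eventually_all_finite hfin]
    intro x _
    by_cases hx : ∃ i, x ∈ (D.node i).inputs ∧ D.subst i x ≠ Term.var x
    · obtain ⟨i, hi, hθ⟩ := hx
      filter_upwards [Filter.eventually_gt_atTop i] with j hj _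
      exact (D.dead_of_lt hI hj hi hθ).subst_eq (D.step j)
    · push Not at hx
      exact Filter.Eventually.of_forall hx
  obtain ⟨n, hn⟩ := Filter.eventually_atTop.1 key
  exact ⟨n, fun i hi x hx => hn i hi x ⟨i, hx⟩ hx⟩

/-- If there is no infinite chain, the input variables have ground instances that are compatible
with the substitutions of the derivation. -/
theorem GenTree.InfiniteDerivation.exists_ground_instances [Nonempty L.Constants]
    (D : (genSLDNFTree R P A I).InfiniteDerivation) (hI : I ⊆ A.vars)
    (h : ∀ x, ¬ D.HasInfiniteChain x) :
    ∃ γ : ℕ → Subst L, (∀ i x, (γ i x).varFinset = ∅) ∧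
      ∀ i, ∀ x ∈ (D.node i).inputs, γ i x = (D.subst i x).subst (γ (i + 1)) := by
  obtain ⟨c⟩ := ‹Nonempty L.Constants›
  obtain ⟨n, hn⟩ := D.exists_forall_input_eq_var hI h
  -- Backward induction from node `n`: later groundings are the constant `c`, and each earlier one
  -- is forced by the mgu of its step. They ground all variables, so that grounding of the next one
  -- suffices for the previous one.
  have key : ∀ k ≤ n, ∃ γ : ℕ → Subst L, (∀ i x, (γ i x).varFinset = ∅) ∧
      ∀ i ≥ n - k, ∀ x ∈ (D.node i).inputs, γ i x = (D.subst i x).subst (γ (i + 1)) := by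
    intro k
    induction k with
    | zero =>
      intro _
      refine ⟨fun _ _ => Term.func c Fin.elim0, fun _ _ => by simp, fun i hi x hx => ?_⟩
      rw [hn i hi x hx]
      rfl
    | succ k ih =>
      intro hk
      obtain ⟨γ, hγ, hγ'⟩ := ih (by omega)
      refine ⟨Function.update γ (n - (k + 1)) fun x => (D.subst (n - (k + 1)) x).subst
        (γ (n - (k + 1) + 1)), fun i x => ?_, fun i hi x hx => ?_⟩
      · by_cases hi : i = n - (k + 1)
        · rw [hi, Function.update_self]
          refine Finset.eq_empty_of_forall_notMem fun y hy => ?_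
          obtain ⟨z, -, hy⟩ := (mem_varFinset_subst _ _ _).1 hy
          simp [hγ] at hy
        · rw [Function.update_of_ne hi]
          exact hγ i x
      · rw [Function.update_of_ne (a := i + 1) (by omega)]
        by_cases hi' : i = n - (k + 1)
        · rw [hi', Function.update_self]
        · rw [Function.update_of_ne hi']
          exact hγ' i (by omega) x hx
  obtain ⟨γ, hγ, hγ'⟩ := key n le_rfl
  exact ⟨γ, hγ, fun i => hγ' i (by omega)⟩

end Chains

/-! ## Moded trees and forests -/

theorem ModedQuery.inputs_subset_vars (Q : ModedQuery L) (ι : Fin Q.arity → ℕ) :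
    Q.inputPositions.image ι ⊆ (Q.instantiate fun i => Term.var (ι i)).vars := by
  intro x hx
  obtain ⟨i, hi, rfl⟩ := Finset.mem_image.1 hx
  simp only [ModedQuery.inputPositions, Finset.mem_filter, Option.isNone_iff_eq_none] at hi
  exact Atom.mem_vars.2 ⟨i, by simp [ModedQuery.instantiate, hi.2]⟩

theorem ModedQuery.instantiate_subst (Q : ModedQuery L) {ι : Fin Q.arity → ℕ} (hι : Q.IsNaming ι)
    {γ : Subst L} (hout : ∀ x ∉ Q.inputPositions.image ι, γ x = Term.var x)
    {t : Fin Q.arity → L.Term ℕ} (ht : ∀ i ∈ Q.inputPositions, γ (ι i) = t i) :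
    (Q.instantiate fun i => Term.var (ι i)).subst γ = Q.instantiate t := by
  simp only [ModedQuery.instantiate, Atom.subst, Atom.mk.injEq, heq_eq_eq, true_and]
  funext j
  cases hj : Q.args j with
  | none => exact ht j (by simp [ModedQuery.inputPositions, hj])
  | some s =>
    refine (subst_eq_self_iff s γ).2 fun x hx => hout x fun hxI => ?_
    obtain ⟨i, hi, rfl⟩ := Finset.mem_image.1 hxI
    exact hι.2 i hi j s hj hx

/-- The root atom of the forest tree is exactly the instance under `γ`, so the identity leads back;
no negation arc has yet been crossed. -/
theorem ModedQuery.tracks_root (Q : ModedQuery L) {ι : Fin Q.arity → ℕ} (hι : Q.IsNaming ι)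
    (R R' : ResolutionRule L) (P : Program L) {γ : Subst L}
    (hground : ∀ x ∈ Q.inputPositions.image ι, (γ x).varFinset = ∅)
    (hout : ∀ x ∉ Q.inputPositions.image ι, γ x = Term.var x)
    {t : Fin Q.arity → L.Term ℕ} (ht : ∀ i ∈ Q.inputPositions, γ (ι i) = t i) :
    Tracks (Q.inputPositions.image ι) γ (modedTree P Q ι R).root
      (genSLDNFTree R' P (Q.instantiate t) ∅).root := by
  have hclosed : ∀ (A : Atom L) (R : ResolutionRule L) (I : Finset ℕ),
      (genSLDNFTree R P A I).root.Closed := by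
    rintro A R I x ⟨l, hl, hx⟩
    rw [List.mem_singleton.1 hl] at hx
    exact hx
  have hs := Q.instantiate_subst hι hout ht
  refine ⟨⟨hground, hout, ⟨γ, fun _ _ => rfl, ?_⟩, Term.var, ?_⟩, Q.inputs_subset_vars ι,
    hclosed _ _ _, hclosed _ _ _, rfl, fun h => ?_⟩
  · simp [Node.lits, genSLDNFTree, modedTree, Literal.subst, hs]
  · simp [Node.lits, genSLDNFTree, modedTree, Literal.subst, hs, Atom.subst_var]
  · simp [genSLDNFTree, modedTree] at h

/-- A derivation of the moded tree without infinite chains has an instance in the forest. -/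
theorem exists_instance_derivation [Nonempty L.Constants] (P : Program L) (Q : ModedQuery L)
    (R' : (Fin Q.arity → L.Term ℕ) → ResolutionRule L) (R : ResolutionRule L)
    {ι : Fin Q.arity → ℕ} (hι : Q.IsNaming ι) (D : (modedTree P Q ι R).InfiniteDerivation)
    (h : ∀ x, ¬ D.HasInfiniteChain x) :
    ∃ T ∈ modedQueryForest P Q R', Nonempty T.InfiniteDerivation := by
  classical
  obtain ⟨γ, hγ, hstep⟩ := GenTree.InfiniteDerivation.exists_ground_instances
    (R := R) (P := P) D (Q.inputs_subset_vars ι) h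
  -- The groundings are cut down to the current input variables, as `IsInputInstance` requires the
  -- identity elsewhere.
  let τ : ℕ → Subst L := fun i x => if x ∈ (D.node i).inputs then γ i x else Term.var x
  have hτin : ∀ i, ∀ x ∈ (D.node i).inputs, τ i x = γ i x := fun i x hx => if_pos hx
  have hτout : ∀ i, ∀ x ∉ (D.node i).inputs, τ i x = Term.var x := fun i x hx => if_neg hx
  have hnext : ∀ i, (D.node (i + 1)).inputs = nextInputs (D.node i).inputs (D.subst i) :=
    fun i => Node.child_inputs (D.step i)
  have hτstep : ∀ i, ∀ x ∈ (D.node i).inputs, τ i x = (D.subst i x).subst (τ (i + 1)) := by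
    intro i x hx
    rw [hτin i x hx, hstep i x hx]
    refine subst_congr fun y hy => (hτin (i + 1) y ?_).symm
    rw [hnext]
    exact mem_nextInputs.2 (Or.inr ⟨x, hx, hy⟩)
  -- At positions without an input mode the value is ignored; it only has to be ground.
  let t : Fin Q.arity → L.Term ℕ := fun i => γ 0 (ι i)
  have h0 : (D.node 0).inputs = Q.inputPositions.image ι := by rw [D.start]; rfl
  have hroot : Tracks (D.node 0).inputs (τ 0) (D.node 0)
      (genSLDNFTree (R' t) P (Q.instantiate t) ∅).root := by
    have := Q.tracks_root hι R (R' t) P (γ := τ 0) (t := t)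
      (fun x hx => by rw [hτin 0 x (h0 ▸ hx)]; exact hγ 0 x)
      (fun x hx => hτout 0 x (h0 ▸ hx))
      (fun i hi => hτin 0 (ι i) (h0 ▸ Finset.mem_image_of_mem ι hi))
    rwa [← D.start, ← h0] at this
  obtain ⟨N', hN'0, hN'⟩ := exists_seq_of_step
    (p := fun i N' => Tracks (D.node i).inputs (τ i) (D.node i) N')
    (q := fun i N' N₁' => ∃ θ', N'.child (R' t) P (D.edge i) = some (θ', N₁')) hroot
    fun i N' hN' => by
      obtain ⟨θ', N₁', h1, h2⟩ := hN'.child (R' := R' t) (γ₁ := τ (i + 1)) (D.step i)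
        (fun x hx => by
          rw [← hnext] at hx
          rw [hτin _ _ hx]
          exact hγ _ _)
        (fun x hx => hτout _ _ (by rwa [hnext])) (hτstep i)
      exact ⟨N₁', by rwa [hnext], θ', h1⟩
  choose θ' hθ' using fun i => (hN' i).2
  exact ⟨_, ⟨t, fun i => hγ 0 (ι i), rfl⟩, ⟨⟨N', D.edge, θ', hN'0, hθ'⟩⟩⟩

/-- A derivation of the forest is an instance of a derivation of the moded tree without infinite
chains. -/
theorem exists_lifted_derivation (P : Program L) (Q : ModedQuery L)
    (R R' : ResolutionRule L) {ι : Fin Q.arity → ℕ} (hι : Q.IsNaming ι)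
    (hnf : (modedTree P Q ι R).NonFloundering) {t : Fin Q.arity → L.Term ℕ}
    (ht : ∀ i, t i ∈ herbrandUniverse L)
    (D' : (genSLDNFTree R' P (Q.instantiate t) ∅).InfiniteDerivation) :
    ∃ D : (modedTree P Q ι R).InfiniteDerivation, ∀ x, ¬ D.HasInfiniteChain x := by
  classical
  let τ : Subst L := fun x =>
    if h : ∃ i ∈ Q.inputPositions, ι i = x then t h.choose else Term.var x
  have hτ : ∀ i ∈ Q.inputPositions, τ (ι i) = t i := by
    intro i hi
    have h : ∃ j ∈ Q.inputPositions, ι j = ι i := ⟨i, hi, rfl⟩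
    simp only [τ, dif_pos h]
    rw [hι.1 h.choose_spec.1 hi h.choose_spec.2]
  have hroot : Tracks (Q.inputPositions.image ι) τ (modedTree P Q ι R).root (D'.node 0) := by
    rw [D'.start]
    refine Q.tracks_root hι R R' P (fun x hx => ?_) (fun x hx => ?_) hτ
    · obtain ⟨i, hi, rfl⟩ := Finset.mem_image.1 hx
      rw [hτ i hi]
      exact ht i
    · exact dif_neg fun ⟨i, hi, h⟩ => hx (h ▸ Finset.mem_image_of_mem ι hi)
  -- The state is a moded node with its grounding. Membership in the tree is carried along so that
  -- non-floundering applies at each step.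
  obtain ⟨f, hf0, hf⟩ := exists_seq_of_step (α := Node L × Subst L)
    (p := fun i a => Tracks a.1.inputs a.2 a.1 (D'.node i) ∧ (modedTree P Q ι R).IsNode a.1)
    (q := fun i a b => ∃ θ, (modedTree P Q ι R).child a.1 (D'.edge i) = some (θ, b.1) ∧
      (∀ x ∈ a.1.inputs, b.2 x = a.2 x) ∧ ∀ x ∈ a.1.inputs, a.2 x = (θ x).subst b.2)
    (a := ((modedTree P Q ι R).root, τ)) ⟨hroot, .root⟩
    fun i a ⟨ha, hnode⟩ => by
      obtain ⟨θ, N₁, γ₁, h1, h2, h3, h4⟩ := ha.lift_child (R := R) (hnf a.1 hnode) (D'.step i)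
      refine ⟨(N₁, γ₁), ⟨?_, .child _ _ _ θ hnode h1⟩, θ, h1, h3, h4⟩
      simpa only [Node.child_inputs h1] using h2
  choose θ hθ using fun i => (hf i).2
  let D : (modedTree P Q ι R).InfiniteDerivation :=
    ⟨fun i => (f i).1, D'.edge, θ, by rw [hf0], fun i => (hθ i).1⟩
  have hnext : ∀ i, (f (i + 1)).1.inputs = nextInputs (f i).1.inputs (θ i) :=
    fun i => Node.child_inputs (hθ i).1
  -- The ground value of an input variable never changes later, so sizes taken at different steps of
  -- a chain can be compared.
  have hmono : ∀ {i j}, i ≤ j → ∀ x ∈ (f i).1.inputs,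
      x ∈ (f j).1.inputs ∧ (f j).2 x = (f i).2 x := by
    intro i j hij x hx
    induction j, hij using Nat.le_induction with
    | base => exact ⟨hx, rfl⟩
    | succ j _ ih =>
      refine ⟨?_, ((hθ j).2.1 x ih.1).trans ih.2⟩
      rw [hnext]
      exact mem_nextInputs.2 (Or.inl ih.1)
  refine ⟨D, fun x ⟨Y, s, hs, hY0, hx, hY⟩ => ?_⟩
  have hsucc : ∀ n, Y n ∈ (f (s n)).1.inputs → Y (n + 1) ∈ (f (s (n + 1))).1.inputs ∧
      termSize ((f (s (n + 1))).2 (Y (n + 1))) < termSize ((f (s n)).2 (Y n)) := by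
    intro n hn
    obtain ⟨m, g, ts, hg, hy⟩ := hY n
    have hg' : θ (s n) (Y n) = Term.func g ts := hg
    have h1 : Y (n + 1) ∈ (f (s n + 1)).1.inputs := by
      rw [hnext]
      exact mem_nextInputs.2 (Or.inr ⟨Y n, hn, hg' ▸ hy⟩)
    obtain ⟨h2, h3⟩ := hmono (hs (Nat.lt_succ_self n)) _ h1
    refine ⟨h2, ?_⟩
    rw [h3, (hθ (s n)).2.2 (Y n) hn, hg']
    exact termSize_subst_var_lt _ hy
  have hin : ∀ n, Y n ∈ (f (s n)).1.inputs := by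
    intro n
    induction n with
    | zero => exact hY0 ▸ hx
    | succ n ih => exact (hsucc n ih).1
  -- A chain would give an infinite strictly decreasing sequence of sizes of ground values.
  obtain ⟨n, hn⟩ := WellFounded.not_rel_apply_succ (r := (· < ·)) fun n => termSize ((f (s n)).2 (Y n))
  exact hn (hsucc n (hin n)).2

end LogicProg

/-! ### The characterization of infinite derivations -/

theorem mainTheorem1 {L : FirstOrder.Language} [Nonempty L.Constants]
    (P : LogicProg.Program L) (Q : LogicProg.ModedQuery L)
    (R' : (Fin Q.arity → L.Term ℕ) → LogicProg.ResolutionRule L)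
    (R : LogicProg.ResolutionRule L)
    (ι : Fin Q.arity → ℕ) (hι : Q.IsNaming ι)
    (hnf : (LogicProg.modedTree P Q ι R).NonFloundering) :
    (∃ T ∈ LogicProg.modedQueryForest P Q R', Nonempty T.InfiniteDerivation) ↔
      ∃ D : (LogicProg.modedTree P Q ι R).InfiniteDerivation,
        (∃ g : ℕ → ℕ, StrictMono g ∧ ∀ j, D.IsLoopGoal (g j) (g (j + 1))) ∧
        ∀ x : ℕ, ¬ D.HasInfiniteChain x := by
  constructor
  · rintro ⟨T, ⟨t, ht, rfl⟩, ⟨D'⟩⟩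
    obtain ⟨D, hD⟩ := LogicProg.exists_lifted_derivation P Q R (R' t) hι hnf ht D'
    exact ⟨D, LogicProg.exists_loop_goals D, hD⟩
  · rintro ⟨D, -, hD⟩
    exact LogicProg.exists_instance_derivation P Q R' R hι D hD
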